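/- **Setting.** Let $(S,h)$ be a connected smooth Riemannian manifold (Hausdorff, without boundary) that is not a single point; no completeness is assumed. Let $0<b\le\infty$, let $f:(0,b)\to(0,\infty)$ be smooth, and consider the past-finite generalized Robertson–Walker (GRW) spacetime $(M,g)=((0,b)\times S,\,-dt^2+f(t)^2h)$ with standard time function $\tau(t,x)=t$, time-oriented so that $\partial_t$ is future-pointing. Let $d_S$ be the Riemannian distance of $(S,h)$ and $\mathrm{diam}(S)\in(0,\infty]$ its diameter. For $0\le u<v\le b$ put $M_{(u,v)}=(u,v)\times S$, and for $0<t\le b$ put $M_t=M_{(0,t)}$. Three distances on $M$, each an infimum of lengths of admissible curves joining two points: * $d^R$ (standard Riemannianized distance): all piecewise smooth curves, with arc length of the Riemannian metric $g+2\,dt^2=dt^2+f(t)^2h$; * $d^N$ (standard null distance): all piecewise causal curves, i.e. curves with finitely many breaks $s_0<\dots<s_m$ whose segments are smooth and each future causal, past causal or constant, with null length $\sum_{i=1}^m|\tau(\beta(s_i))-\tau(\beta(s_{i-1}))|$; * $d^E$ (standard elevator distance): all curves with finitely many smooth segments, each purely vertical ($x$ constant) or purely horizontal ($t$ constant), with arc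 length of $dt^2+f(t)^2h$. For $Z\in\{R,N,E\}$ and $V\subset M$ let $\mathrm{diam}^Z(V)=\sup_{p,q\in V}d^Z(p,q)$, and let $\mathrm{diam}^Z_{\mathrm{int}}(V)$ be the supremum over $p,q\in V$ of the intrinsic distance of $V$, the infimum of lengths over admissible curves that stay inside $V$. Diameters take values in $[0,\infty]$. Let $\overline M_Z$ be the metric completion of $(M,d^Z)$. **Theorem.** For each $Z\in\{R,N,E\}$, the function $\tau$ has a unique continuous extension $\overline\tau_Z:\overline M_Z\to\mathbb R$, and the following hold. 1. The following are equivalent: * (S1) $f(t_k)\to0$ for some sequence $t_k\to0^+$ in $(0,b)$; * (S2) $\mathrm{diam}^Z(M_t)\to0$ as $t\to0^+$; * (S3) $\overline\tau_Z^{-1}(0)=\{\overline p_0\}$ is a single point (a big bang point). 2. If $\mathrm{diam}(S)<\infty$, the following are equivalent: * (U1) $f(t)\to0$ as $t\to0^+$; * (U2) $\sup\{\mathrm{diam}^Z_{\mathrm{int}}(M_{(u,v)}):0\le u<v\le t\}\to0$ as $t\to0^+$. -/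

import Mathlib

open Set Filter Topology Manifold MeasureTheory
open scoped ENNReal ContDiff

noncomputable section

/-! ### Piecewise curves and the induced length distances -/

section LengthStructures

variable {X : Type*}

/-- `γ` restricted to `[s 0, s m]` is a path from `p` to `q` inside `W`, with finitely many breaks
`s 0 < s 1 < ⋯ < s m`, each restriction to `[s i, s (i + 1)]` being an admissible segment. (The
case `m = 0` is the trivial path at `p = q`.) -/
structure IsPiecewise (Seg : (ℝ → X) → ℝ → ℝ → Prop) (W : Set X) (p q : X)
    (γ : ℝ → X) (m : ℕ) (s : ℕ → ℝ) : Prop where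
  lt_succ : ∀ i < m, s i < s (i + 1)
  seg : ∀ i < m, Seg γ (s i) (s (i + 1))
  mem : ∀ t ∈ Icc (s 0) (s m), γ t ∈ W
  start : γ (s 0) = p
  finish : γ (s m) = q

/-- The lengths of all piecewise admissible paths from `p` to `q` inside `W`; the length of a path
is the sum of the lengths of its segments. -/
def curveLengths (Seg : (ℝ → X) → ℝ → ℝ → Prop) (len : (ℝ → X) → ℝ → ℝ → ℝ≥0∞)
    (W : Set X) (p q : X) : Set ℝ≥0∞ :=
  {L | ∃ (γ : ℝ → X) (m : ℕ) (s : ℕ → ℝ), IsPiecewise Seg W p q γ m s ∧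
    L = ∑ i ∈ Finset.range m, len γ (s i) (s (i + 1))}

/-- The intrinsic length distance in `W`: the infimum of the lengths of admissible paths inside `W`
(`⊤` if there are none). -/
def curveEDist (Seg : (ℝ → X) → ℝ → ℝ → Prop) (len : (ℝ → X) → ℝ → ℝ → ℝ≥0∞)
    (W : Set X) (p q : X) : ℝ≥0∞ :=
  sInf (curveLengths Seg len W p q)

/-- Segments and their lengths only depend on the curve over the parameter interval, and are
invariant under translation and reversal of the parameter. -/
structure IsLengthClass (Seg : (ℝ → X) → ℝ → ℝ → Prop)
    (len : (ℝ → X) → ℝ → ℝ → ℝ≥0∞) : Prop where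
  congr : ∀ {γ γ' : ℝ → X} {a b : ℝ}, a < b → EqOn γ' γ (Icc a b) → Seg γ a b →
    Seg γ' a b ∧ len γ' a b = len γ a b
  shift : ∀ {γ : ℝ → X} {a b : ℝ} (c : ℝ), a < b → Seg γ a b →
    Seg (fun t => γ (t - c)) (a + c) (b + c) ∧
      len (fun t => γ (t - c)) (a + c) (b + c) = len γ a b
  neg : ∀ {γ : ℝ → X} {a b : ℝ}, a < b → Seg γ a b →
    Seg (fun t => γ (-t)) (-b) (-a) ∧ len (fun t => γ (-t)) (-b) (-a) = len γ a b

variable {Seg : (ℝ → X) → ℝ → ℝ → Prop} {len : (ℝ → X) → ℝ → ℝ → ℝ≥0∞} {W : Set X}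

theorem IsPiecewise.le {p q : X} {γ : ℝ → X} {m : ℕ} {s : ℕ → ℝ}
    (H : IsPiecewise Seg W p q γ m s) {i j : ℕ} (hij : i ≤ j) (hj : j ≤ m) : s i ≤ s j := by
  induction j, hij using Nat.le_induction with
  | base => exact le_rfl
  | succ k hk ih => exact (ih (by omega)).trans (H.lt_succ k (by omega)).le

theorem curveEDist_self {p : X} (hp : p ∈ W) : curveEDist Seg len W p p = 0 := by
  refine le_antisymm (sInf_le ⟨fun _ => p, 0, fun _ => 0, ?_, by simp⟩) bot_le
  exact ⟨by simp, by simp, fun _ _ => hp, rfl, rfl⟩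

theorem curveEDist_comm_le (h : IsLengthClass Seg len) (p q : X) :
    curveEDist Seg len W q p ≤ curveEDist Seg len W p q := by
  refine le_sInf ?_
  rintro L ⟨γ, m, s, H, rfl⟩
  have key : ∀ i < m, m - i = m - (i + 1) + 1 := fun i hi => by omega
  refine sInf_le ⟨fun t => γ (-t), m, fun i => -s (m - i), ⟨?_, ?_, ?_, ?_, ?_⟩, ?_⟩
  · intro i hi
    have := H.lt_succ (m - (i + 1)) (by omega)
    rw [key i hi]
    simpa using this
  · intro i hi
    have h1 := H.lt_succ (m - (i + 1)) (by omega)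
    have h2 := H.seg (m - (i + 1)) (by omega)
    have := (h.neg h1 h2).1
    rw [key i hi]
    exact this
  · intro t ht
    refine H.mem _ ?_
    simp only [Nat.sub_zero, Nat.sub_self, mem_Icc] at ht ⊢
    constructor <;> linarith [ht.1, ht.2]
  · simpa using H.finish
  · simpa using H.start
  · rw [← Finset.sum_range_reflect]
    refine Finset.sum_congr rfl fun i hi => ?_
    have hi := Finset.mem_range.1 hi
    have h1 := H.lt_succ (m - (i + 1)) (by omega)
    have h2 := H.seg (m - (i + 1)) (by omega)
    have := (h.neg h1 h2).2
    have h3 : m - 1 - i = m - (i + 1) := by omega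
    simp only [h3, key i hi, this]

theorem curveEDist_comm (h : IsLengthClass Seg len) (p q : X) :
    curveEDist Seg len W p q = curveEDist Seg len W q p :=
  le_antisymm (curveEDist_comm_le h q p) (curveEDist_comm_le h p q)

theorem add_mem_curveLengths (h : IsLengthClass Seg len) {p q r : X} {L₁ L₂ : ℝ≥0∞}
    (h₁ : L₁ ∈ curveLengths Seg len W p q) (h₂ : L₂ ∈ curveLengths Seg len W q r) :
    L₁ + L₂ ∈ curveLengths Seg len W p r := by
  obtain ⟨γ₁, m₁, s₁, H₁, rfl⟩ := h₁
  obtain ⟨γ₂, m₂, s₂, H₂, rfl⟩ := h₂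
  set c : ℝ := s₁ m₁ - s₂ 0 with hc
  set γ : ℝ → X := fun t => if t ≤ s₁ m₁ then γ₁ t else γ₂ (t - c) with hγ
  set s : ℕ → ℝ := fun i => if i ≤ m₁ then s₁ i else s₂ (i - m₁) + c with hs
  have hγ1 : ∀ t ≤ s₁ m₁, γ t = γ₁ t := fun t ht => if_pos ht
  have hγ2 : ∀ t, s₁ m₁ ≤ t → γ t = γ₂ (t - c) := by
    intro t ht
    rcases ht.eq_or_lt with rfl | ht
    · rw [hγ1 _ le_rfl, H₁.finish, ← H₂.start]
      congr 1
      rw [hc]; ring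
    · exact if_neg (not_le.2 ht)
  have hs1 : ∀ i ≤ m₁, s i = s₁ i := fun i hi => if_pos hi
  have hs2 : ∀ i, s (m₁ + i) = s₂ i + c := by
    intro i
    rcases Nat.eq_zero_or_pos i with rfl | hi
    · rw [Nat.add_zero, hs1 _ le_rfl, hc]; ring
    · have : ¬ (m₁ + i ≤ m₁) := by omega
      simp only [hs, if_neg this, Nat.add_sub_cancel_left]
  have hge : ∀ i ≤ m₂, s₁ m₁ ≤ s₂ i + c := by
    intro i hi
    have := H₂.le (Nat.zero_le i) hi
    rw [hc]; linarith
  have A : ∀ i < m₁, Seg γ (s i) (s (i + 1)) ∧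
      len γ (s i) (s (i + 1)) = len γ₁ (s₁ i) (s₁ (i + 1)) := by
    intro i hi
    rw [hs1 i hi.le, hs1 (i + 1) hi]
    exact h.congr (H₁.lt_succ i hi)
      (fun t ht => hγ1 t (ht.2.trans (H₁.le (by omega) le_rfl))) (H₁.seg i hi)
  have B : ∀ i < m₂, Seg γ (s (m₁ + i)) (s (m₁ + i + 1)) ∧
      len γ (s (m₁ + i)) (s (m₁ + i + 1)) = len γ₂ (s₂ i) (s₂ (i + 1)) := by
    intro i hi
    have h1 := H₂.lt_succ i hi
    rw [add_assoc, hs2 i, hs2 (i + 1)]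
    have h2 := h.shift c h1 (H₂.seg i hi)
    have h3 := h.congr (γ' := γ) (by linarith)
      (fun t ht => hγ2 t ((hge i hi.le).trans ht.1)) h2.1
    exact ⟨h3.1, h3.2.trans h2.2⟩
  refine ⟨γ, m₁ + m₂, s, ⟨?_, ?_, ?_, ?_, ?_⟩, ?_⟩
  · intro i hi
    rcases lt_or_ge i m₁ with h' | h'
    · rw [hs1 i h'.le, hs1 (i + 1) h']
      exact H₁.lt_succ i h'
    · obtain ⟨j, rfl⟩ := Nat.exists_eq_add_of_le h'
      rw [add_assoc, hs2, hs2]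
      linarith [H₂.lt_succ j (by omega)]
  · intro i hi
    rcases lt_or_ge i m₁ with h' | h'
    · exact (A i h').1
    · obtain ⟨j, rfl⟩ := Nat.exists_eq_add_of_le h'
      exact (B j (by omega)).1
  · intro t ht
    rw [hs1 0 (Nat.zero_le _), hs2] at ht
    rcases le_total t (s₁ m₁) with h' | h'
    · rw [hγ1 t h']
      exact H₁.mem t ⟨ht.1, h'⟩
    · rw [hγ2 t h']
      refine H₂.mem _ ⟨?_, ?_⟩
      · rw [hc]; linarith
      · linarith [ht.2]
  · rw [hs1 0 (Nat.zero_le _), hγ1 _ (H₁.le (Nat.zero_le _) le_rfl), H₁.start]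
  · rw [hs2, hγ2 _ (hge m₂ le_rfl), ← H₂.finish]
    congr 1
    ring
  · rw [Finset.sum_range_add]
    congr 1
    · exact Finset.sum_congr rfl fun i hi => ((A i (Finset.mem_range.1 hi)).2).symm
    · exact Finset.sum_congr rfl fun i hi => ((B i (Finset.mem_range.1 hi)).2).symm

theorem curveEDist_triangle (h : IsLengthClass Seg len) (p q r : X) :
    curveEDist Seg len W p r ≤ curveEDist Seg len W p q + curveEDist Seg len W q r := by
  unfold curveEDist
  rw [ENNReal.sInf_add]
  refine le_iInf₂ fun a ha => ?_
  rw [add_comm, ENNReal.sInf_add]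
  refine le_iInf₂ fun b hb => ?_
  rw [add_comm]
  exact sInf_le (add_mem_curveLengths h ha hb)

end LengthStructures

/-! ### Smooth segments and arc length on a manifold -/

section ArcLength

variable {E : Type*} [NormedAddCommGroup E] [NormedSpace ℝ E] {H : Type*} [TopologicalSpace H]
  (I : ModelWithCorners ℝ E H) {N : Type*} [TopologicalSpace N] [ChartedSpace H N]

/-- `γ` restricted to the closed interval `[a, b]` is smooth. -/
def SmoothSeg (γ : ℝ → N) (a b : ℝ) : Prop :=
  ContMDiffOn 𝓘(ℝ, ℝ) I ∞ γ (Icc a b)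

/-- The velocity `γ'(s)` of `γ` restricted to `[a, b]` (one-sided at the endpoints). -/
def velocity (γ : ℝ → N) (a b s : ℝ) : TangentSpace I (γ s) :=
  mfderivWithin 𝓘(ℝ, ℝ) I γ (Icc a b) s (1 : ℝ)

/-- The arc length `∫ √(Q(γ', γ')) ds` over `[a, b]`, for a quadratic form `Q` on tangent
vectors. -/
def arcLength (Q : ∀ p : N, TangentSpace I p → ℝ) (γ : ℝ → N) (a b : ℝ) : ℝ≥0∞ :=
  ∫⁻ s in Icc a b, ENNReal.ofReal (√(Q (γ s) (velocity I γ a b s)))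

variable {I}

theorem SmoothSeg.congr {γ γ' : ℝ → N} {a b : ℝ} (h : EqOn γ' γ (Icc a b))
    (hs : SmoothSeg I γ a b) : SmoothSeg I γ' a b :=
  ContMDiffOn.congr hs h

/-- A property of tangent vectors transfers between curves that agree on `[a, b]`. -/
theorem velocity_congr {α : Sort*} (F : ∀ p : N, TangentSpace I p → α) {γ γ' : ℝ → N} {a b s : ℝ}
    (h : EqOn γ' γ (Icc a b)) (hs : s ∈ Icc a b) :
    F (γ' s) (velocity I γ' a b s) = F (γ s) (velocity I γ a b s) := by
  have h1 : mfderivWithin 𝓘(ℝ, ℝ) I γ' (Icc a b) s = mfderivWithin 𝓘(ℝ, ℝ) I γ (Icc a b) s :=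
    mfderivWithin_congr_of_mem h hs
  have h2 : γ' s = γ s := h hs
  have h3 : (velocity I γ' a b s : E) = (velocity I γ a b s : E) :=
    congrArg (fun T : ℝ →L[ℝ] E => T 1) h1
  have : ∀ (x y : N) (v : E) (w : E), x = y → v = w →
      F x (v : TangentSpace I x) = F y (w : TangentSpace I y) := by
    rintro x _ v _ rfl rfl; rfl
  exact this _ _ _ _ h2 h3

theorem velocity_comp_affine {γ : ℝ → N} {a b a' b' e c : ℝ} (hab : a' < b')
    (hs : SmoothSeg I γ a b) (hm : MapsTo (fun t : ℝ => e * t + c) (Icc a' b') (Icc a b))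
    {s : ℝ} (hmem : s ∈ Icc a' b') :
    velocity I (fun t => γ (e * t + c)) a' b' s = e • velocity I γ a b (e * s + c) := by
  have hφ : HasFDerivAt (fun t : ℝ => e * t + c) (e • ContinuousLinearMap.id ℝ ℝ) s := by
    have := (((hasDerivAt_id s).const_mul e).add_const c).hasFDerivAt
    refine this.congr_fderiv ?_
    ext
    simp
  have hu : UniqueMDiffWithinAt 𝓘(ℝ, ℝ) (Icc a' b') s :=
    uniqueMDiffWithinAt_iff_uniqueDiffWithinAt.2 (uniqueDiffOn_Icc hab s hmem)
  have hg : MDifferentiableWithinAt 𝓘(ℝ, ℝ) I γ (Icc a b) (e * s + c) :=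
    (hs.mdifferentiableOn (by simp)) _ (hm hmem)
  have hd : HasMFDerivWithinAt 𝓘(ℝ, ℝ) 𝓘(ℝ, ℝ) (fun t : ℝ => e * t + c) (Icc a' b') s
      (e • ContinuousLinearMap.id ℝ ℝ) :=
    hφ.hasFDerivWithinAt.hasMFDerivWithinAt
  have := (HasMFDerivWithinAt.comp (u := Icc a b) s hg.hasMFDerivWithinAt hd
    hm).mfderivWithin hu
  have h2 := congrArg (fun T : ℝ →L[ℝ] E => T 1) this
  exact Eq.trans h2 (ContinuousLinearMap.map_smul
    (mfderivWithin 𝓘(ℝ, ℝ) I γ (Icc a b) (e * s + c) : ℝ →L[ℝ] E) e (1 : ℝ))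

theorem SmoothSeg.comp_affine {γ : ℝ → N} {a b a' b' e c : ℝ} (hs : SmoothSeg I γ a b)
    (hm : MapsTo (fun t : ℝ => e * t + c) (Icc a' b') (Icc a b)) :
    SmoothSeg I (fun t => γ (e * t + c)) a' b' := by
  refine ContMDiffOn.comp (g := γ) (f := fun t : ℝ => e * t + c) hs ?_ hm
  rw [contMDiffOn_iff_contDiffOn]
  fun_prop

theorem arcLength_congr {Q : ∀ p : N, TangentSpace I p → ℝ} {γ γ' : ℝ → N} {a b : ℝ}
    (h : EqOn γ' γ (Icc a b)) : arcLength I Q γ' a b = arcLength I Q γ a b := by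
  refine setLIntegral_congr_fun measurableSet_Icc fun s hs => ?_
  exact velocity_congr (fun p v => ENNReal.ofReal (√(Q p v))) h hs

/-- Smooth segments with arc length form a length class. -/
theorem isLengthClass_smooth {Q : ∀ p : N, TangentSpace I p → ℝ}
    (hQ : ∀ p (v : TangentSpace I p), Q p (-v) = Q p v) :
    IsLengthClass (SmoothSeg I (N := N)) (arcLength I Q) where
  congr _ h hs := ⟨hs.congr h, arcLength_congr h⟩
  shift {γ a b} c hab hs := by
    have e1 : (fun t => γ (t - c)) = fun t => γ (1 * t + -c) := by ext; ring_nf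
    have hm : MapsTo (fun t : ℝ => 1 * t + -c) (Icc (a + c) (b + c)) (Icc a b) := by
      intro t ht
      constructor <;> simp only <;> linarith [ht.1, ht.2]
    rw [e1]
    refine ⟨hs.comp_affine hm, ?_⟩
    have hp : MeasurePreserving (fun t : ℝ => t + -c) volume volume :=
      measurePreserving_add_right volume (-c)
    have hpre : (fun t : ℝ => t + -c) ⁻¹' Icc a b = Icc (a + c) (b + c) := by
      ext t; simp [← sub_eq_add_neg]
    have := hp.setLIntegral_comp_preimage_emb
      (MeasurableEquiv.addRight (-c)).measurableEmbedding
      (fun s => ENNReal.ofReal (√(Q (γ s) (velocity I γ a b s)))) (Icc a b)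
    rw [hpre] at this
    unfold arcLength
    rw [← this]
    refine setLIntegral_congr_fun measurableSet_Icc fun s hs' => ?_
    simp only
    rw [velocity_comp_affine (by linarith) hs hm hs', one_smul, one_mul]
  neg {γ a b} hab hs := by
    have e1 : (fun t => γ (-t)) = fun t => γ (-1 * t + 0) := by ext; ring_nf
    have hm : MapsTo (fun t : ℝ => -1 * t + 0) (Icc (-b) (-a)) (Icc a b) := by
      intro t ht
      constructor <;> simp only <;> linarith [ht.1, ht.2]
    rw [e1]
    refine ⟨hs.comp_affine hm, ?_⟩
    have hp : MeasurePreserving (fun t : ℝ => -t) volume volume :=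
      Measure.measurePreserving_neg volume
    have hpre : (fun t : ℝ => -t) ⁻¹' Icc a b = Icc (-b) (-a) := by
      ext t; simp only [mem_preimage, mem_Icc]; constructor <;> intro h <;>
        constructor <;> linarith [h.1, h.2]
    have := hp.setLIntegral_comp_preimage_emb
      (MeasurableEquiv.neg ℝ).measurableEmbedding
      (fun s => ENNReal.ofReal (√(Q (γ s) (velocity I γ a b s)))) (Icc a b)
    rw [hpre] at this
    unfold arcLength
    rw [← this]
    refine setLIntegral_congr_fun measurableSet_Icc fun s hs' => ?_
    simp only
    rw [velocity_comp_affine (by linarith) hs hm hs', neg_one_smul, hQ, neg_one_mul, add_zero]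

end ArcLength

/-! ### Generalized Robertson-Walker spacetimes -/

section GRW

variable {n : ℕ} {S : Type*} [TopologicalSpace S] [ChartedSpace (EuclideanSpace ℝ (Fin n)) S]

/-- A smooth Riemannian metric tensor `h` on the `n`-dimensional manifold `S`. -/
abbrev SpatialMetric (n : ℕ) (S : Type*) [TopologicalSpace S]
    [ChartedSpace (EuclideanSpace ℝ (Fin n)) S] [IsManifold (𝓡 n) ∞ S] :=
  Bundle.ContMDiffRiemannianMetric (𝓡 n) ∞ (EuclideanSpace ℝ (Fin n))
    (fun x : S => TangentSpace (𝓡 n) x)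

/-- The model of the product manifold `ℝ × S`, which contains `I × S` as an open subset. -/
abbrev grwModel (n : ℕ) := 𝓘(ℝ, ℝ).prod (𝓡 n)

/-- The differential `dt` of the standard time function `(t, x) ↦ t`. -/
def dTime (p : ℝ × S) (v : TangentSpace (grwModel n) p) : ℝ :=
  mfderiv (grwModel n) 𝓘(ℝ, ℝ) (Prod.fst : ℝ × S → ℝ) p v

/-- The differential of the projection `(t, x) ↦ x`. -/
def dSpace (p : ℝ × S) (v : TangentSpace (grwModel n) p) : TangentSpace (𝓡 n) p.2 :=
  mfderiv (grwModel n) (𝓡 n) (Prod.snd : ℝ × S → S) p v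

/-- The slab `(u, v) × S`. -/
def slab (S : Type*) (u v : EReal) : Set (ℝ × S) :=
  {p | u < (p.1 : EReal) ∧ (p.1 : EReal) < v}

theorem dTime_neg (p : ℝ × S) (v : TangentSpace (grwModel n) p) :
    dTime p (-v) = -dTime p v :=
  ContinuousLinearMap.map_neg _ v

theorem dSpace_neg (p : ℝ × S) (v : TangentSpace (grwModel n) p) :
    dSpace p (-v) = -dSpace p v :=
  ContinuousLinearMap.map_neg _ v

variable [IsManifold (𝓡 n) ∞ S] (h : SpatialMetric n S) (f : ℝ → ℝ)

/-- The Lorentzian warped product metric `g = -dt² + f(t)² h`. -/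
def lorentzMetric (p : ℝ × S) (v w : TangentSpace (grwModel n) p) : ℝ :=
  -(dTime p v * dTime p w) + f p.1 ^ 2 * h.inner p.2 (dSpace p v) (dSpace p w)

/-- The standard Riemannianization `g + 2 dt²`, that is `dt² + f(t)² h`. -/
def riemMetric (p : ℝ × S) (v w : TangentSpace (grwModel n) p) : ℝ :=
  lorentzMetric h f p v w + 2 * (dTime p v * dTime p w)

/-- Future-pointing causal vectors; the time orientation is the one in which `∂_t` is
future-pointing. (The condition `0 < dt(v)` forces `v ≠ 0`.) -/
def IsFutureCausal (p : ℝ × S) (v : TangentSpace (grwModel n) p) : Prop :=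
  lorentzMetric h f p v v ≤ 0 ∧ 0 < dTime p v

/-- A smooth segment that is future causal, past causal, or constant. -/
def CausalSeg (γ : ℝ → ℝ × S) (a b : ℝ) : Prop :=
  SmoothSeg (grwModel n) γ a b ∧
    ((∀ s ∈ Icc a b, IsFutureCausal h f (γ s) (velocity (grwModel n) γ a b s)) ∨
      (∀ s ∈ Icc a b, IsFutureCausal h f (γ s) (-velocity (grwModel n) γ a b s)) ∨
      (∀ s ∈ Icc a b, ∀ s' ∈ Icc a b, γ s = γ s'))

/-- The null length `|τ(γ b) - τ(γ a)|` of a segment, for the standard time `τ(t, x) = t`. -/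
def nullLength (γ : ℝ → ℝ × S) (a b : ℝ) : ℝ≥0∞ :=
  ENNReal.ofReal |(γ b).1 - (γ a).1|

/-- A smooth segment that is purely vertical or purely horizontal. -/
def VertHorizSeg (n : ℕ) {S : Type*} [TopologicalSpace S]
    [ChartedSpace (EuclideanSpace ℝ (Fin n)) S] (γ : ℝ → ℝ × S) (a b : ℝ) : Prop :=
  SmoothSeg (grwModel n) γ a b ∧
    ((∀ s ∈ Icc a b, ∀ s' ∈ Icc a b, (γ s).2 = (γ s').2) ∨
      (∀ s ∈ Icc a b, ∀ s' ∈ Icc a b, (γ s).1 = (γ s').1))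

/-- Arc length with respect to the standard Riemannianization. -/
def riemLength (γ : ℝ → ℝ × S) (a b : ℝ) : ℝ≥0∞ :=
  arcLength (grwModel n) (fun p v => riemMetric h f p v v) γ a b

/-- The three kinds of distance: Riemannianized, null, elevator. -/
inductive DistKind
  | R
  | N
  | E

/-- Admissible segments: smooth, causal, or vertical-or-horizontal. -/
def DistKind.Seg : DistKind → (ℝ → ℝ × S) → ℝ → ℝ → Prop
  | .R => SmoothSeg (grwModel n)
  | .N => CausalSeg h f
  | .E => VertHorizSeg n

/-- Length of segments: Riemannianized arc length, or null length. -/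
def DistKind.len : DistKind → (ℝ → ℝ × S) → ℝ → ℝ → ℝ≥0∞
  | .R => riemLength h f
  | .N => nullLength
  | .E => riemLength h f

/-- The intrinsic distance of kind `Z` in a subset `W`. For `W = M` it is `d^Z`. -/
def grwDist (Z : DistKind) (W : Set (ℝ × S)) (p q : ℝ × S) : ℝ≥0∞ :=
  curveEDist (Z.Seg h f) (Z.len h f) W p q

/-- The diameter of `V` with respect to the intrinsic distance of `W`. With `W = M` this is
the extrinsic diameter of `V` in `M`; with `W = V` it is the intrinsic diameter of `V`. -/
def grwDiam (Z : DistKind) (W V : Set (ℝ × S)) : ℝ≥0∞ :=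
  ⨆ p ∈ V, ⨆ q ∈ V, grwDist h f Z W p q

/-- The Riemannian distance `d_S` of `(S, h)`: infimum of the lengths of piecewise smooth curves. -/
def spatialDist (x y : S) : ℝ≥0∞ :=
  curveEDist (SmoothSeg (𝓡 n)) (arcLength (𝓡 n) (fun x v => h.inner x v v)) univ x y

/-- The diameter of `(S, d_S)`. -/
def spatialDiam : ℝ≥0∞ :=
  ⨆ (x : S) (y : S), spatialDist h x y

variable {h f}

theorem lorentzMetric_neg (p : ℝ × S) (v : TangentSpace (grwModel n) p) :
    lorentzMetric h f p (-v) (-v) = lorentzMetric h f p v v := by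
  simp [lorentzMetric, dTime_neg, dSpace_neg]

theorem riemMetric_neg (p : ℝ × S) (v : TangentSpace (grwModel n) p) :
    riemMetric h f p (-v) (-v) = riemMetric h f p v v := by
  simp [riemMetric, lorentzMetric_neg, dTime_neg]

theorem isLengthClass_riem :
    IsLengthClass (SmoothSeg (grwModel n) (N := ℝ × S)) (riemLength h f) :=
  isLengthClass_smooth (I := grwModel n) (Q := fun p v => riemMetric h f p v v) riemMetric_neg

theorem isLengthClass_elevator :
    IsLengthClass (VertHorizSeg n (S := S)) (riemLength h f) where
  congr hab he hs := by
    obtain ⟨h1, h2⟩ := isLengthClass_riem.congr hab he hs.1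
    refine ⟨⟨h1, hs.2.imp ?_ ?_⟩, h2⟩ <;>
      · intro H s hs s' hs'
        rw [he hs, he hs']
        exact H s hs s' hs'
  shift c hab hs := by
    obtain ⟨h1, h2⟩ := isLengthClass_riem.shift c hab hs.1
    refine ⟨⟨h1, hs.2.imp ?_ ?_⟩, h2⟩ <;>
      · intro H s hs s' hs'
        exact H _ ⟨by linarith [hs.1], by linarith [hs.2]⟩ _
          ⟨by linarith [hs'.1], by linarith [hs'.2]⟩
  neg hab hs := by
    obtain ⟨h1, h2⟩ := isLengthClass_riem.neg hab hs.1
    refine ⟨⟨h1, hs.2.imp ?_ ?_⟩, h2⟩ <;>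
      · intro H s hs s' hs'
        exact H _ ⟨by linarith [hs.2], by linarith [hs.1]⟩ _
          ⟨by linarith [hs'.2], by linarith [hs'.1]⟩

theorem isLengthClass_null : IsLengthClass (CausalSeg h f) (nullLength (S := S)) where
  congr {γ γ' a b} hab he hs := by
    refine ⟨⟨hs.1.congr he, hs.2.imp ?_ (Or.imp ?_ ?_)⟩, ?_⟩
    · intro H s hs
      exact (velocity_congr (fun p v => IsFutureCausal h f p v) he hs).symm ▸ H s hs
    · intro H s hs
      exact (velocity_congr (fun p v => IsFutureCausal h f p (-v)) he hs).symm ▸ H s hs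
    · intro H s hs s' hs'
      rw [he hs, he hs']
      exact H s hs s' hs'
    · rw [nullLength, nullLength, he (right_mem_Icc.2 hab.le), he (left_mem_Icc.2 hab.le)]
  shift {γ a b} c hab hs := by
    have e1 : (fun t => γ (t - c)) = fun t => γ (1 * t + -c) := by ext <;> ring_nf
    have hm : MapsTo (fun t : ℝ => 1 * t + -c) (Icc (a + c) (b + c)) (Icc a b) := by
      intro t ht
      constructor <;> simp only <;> linarith [ht.1, ht.2]
    refine ⟨⟨?_, hs.2.imp ?_ (Or.imp ?_ ?_)⟩, by simp [nullLength]⟩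
    · rw [e1]; exact hs.1.comp_affine hm
    · intro H s hs'
      rw [e1, velocity_comp_affine (by linarith) hs.1 hm hs', one_smul]
      exact H _ (hm hs')
    · intro H s hs'
      rw [e1, velocity_comp_affine (by linarith) hs.1 hm hs', one_smul]
      exact H _ (hm hs')
    · intro H s hs s' hs'
      exact H _ ⟨by linarith [hs.1], by linarith [hs.2]⟩ _
        ⟨by linarith [hs'.1], by linarith [hs'.2]⟩
  neg {γ a b} hab hs := by
    have e1 : (fun t => γ (-t)) = fun t => γ (-1 * t + 0) := by ext <;> ring_nf
    have hm : MapsTo (fun t : ℝ => -1 * t + 0) (Icc (-b) (-a)) (Icc a b) := by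
      intro t ht
      constructor <;> simp only <;> linarith [ht.1, ht.2]
    refine ⟨⟨?_, ?_⟩, by simp [nullLength, abs_sub_comm]⟩
    · rw [e1]; exact hs.1.comp_affine hm
    · rcases hs.2 with H | H | H
      · refine Or.inr (Or.inl fun s hs' => ?_)
        rw [e1, velocity_comp_affine (by linarith) hs.1 hm hs', neg_one_smul, neg_neg]
        exact H _ (hm hs')
      · refine Or.inl fun s hs' => ?_
        rw [e1, velocity_comp_affine (by linarith) hs.1 hm hs', neg_one_smul]
        exact H _ (hm hs')
      · refine Or.inr (Or.inr fun s hs s' hs' => ?_)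
        exact H _ ⟨by linarith [hs.2], by linarith [hs.1]⟩ _
          ⟨by linarith [hs'.2], by linarith [hs'.1]⟩

theorem DistKind.isLengthClass (Z : DistKind) : IsLengthClass (Z.Seg h f) (Z.len h f) :=
  match Z with
  | .R => isLengthClass_riem
  | .N => isLengthClass_null
  | .E => isLengthClass_elevator

variable (h f)

/-- The set `M = (0, b) × S`, to be equipped with the distance `d^Z`. -/
def GRWSpace (_h : SpatialMetric n S) (_f : ℝ → ℝ) (b : EReal) (_Z : DistKind) : Type _ :=
  {p : ℝ × S // p ∈ slab S 0 b}

instance (b : EReal) (Z : DistKind) : PseudoEMetricSpace (GRWSpace h f b Z) where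
  edist p q := grwDist h f Z (slab S 0 b) p.1 q.1
  edist_self p := curveEDist_self p.2
  edist_comm p q := curveEDist_comm Z.isLengthClass p.1 q.1
  edist_triangle p q r := curveEDist_triangle Z.isLengthClass p.1 q.1 r.1

/-- The standard time function `τ(t, x) = t` on `M`. -/
def GRWSpace.time {h : SpatialMetric n S} {f : ℝ → ℝ} {b : EReal} {Z : DistKind} (p : GRWSpace h f b Z) : ℝ := p.1.1

/-- The metric completion of `(M, d^Z)`. -/
abbrev GRWCompletion (b : EReal) (Z : DistKind) : Type _ :=
  UniformSpace.Completion (GRWSpace h f b Z)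

end GRW

end

/-! ### Generalities on length distances -/

section LengthStructures

variable {X : Type*} {Seg : (ℝ → X) → ℝ → ℝ → Prop} {len : (ℝ → X) → ℝ → ℝ → ℝ≥0∞} {W : Set X}

/-! The three distances are handled together, because each satisfies the same four estimates. From
below, a segment is at least as long as the time it spans (`DistKind.ofReal_abs_sub_le_len`), and at
least `c` times the `d_S`-distance of the projections of its ends if `f ≥ c` along it
(`DistKind.mul_spatialDist_le_len`). From above, a vertical move costs at most the elapsed time
(`grwDist_vertical_le`), and a move along the level `r` costs at most `f r` times `d_S`
(`grwDist_horizontal_le`). Only the null distance needs real work for the last bound: a spatial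
curve is shadowed by many short null zigzags near the level. Combining the upper bounds, two points
of a slab are joined through any level `r` in it (`grwDist_slab_le`).

Time is therefore 1-Lipschitz and extends uniquely to the completion. If `f (t k) → 0`, routing two
fixed points of `M_s` through the levels `t k` makes the horizontal cost vanish, so the diameter is
at most `2s`; this needs `d_S` finite, not bounded. Shrinking diameters leave at most one point over
time zero, and limits of vertical lines provide one. Conversely, if `f ≥ ε` on `(0, δ)`, two
vertical lines over distinct points stay apart: a connecting curve either remains below `δ` and pays
for the spatial distance, or climbs to `δ` and pays for the time (`min_le_grwDist`). Their limits
then differ.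

For uniform pinching, a curve confined to a thin slab cannot escape to a level where `f` is small.
The intrinsic diameters thus detect `f` at every level. Finiteness of `diam S` makes the horizontal
cost uniformly small when `f → 0`. -/

theorem curveEDist_le_len {γ : ℝ → X} {a b : ℝ} (hab : a < b) (hγ : Seg γ a b)
    (hW : ∀ t ∈ Icc a b, γ t ∈ W) : curveEDist Seg len W (γ a) (γ b) ≤ len γ a b := by
  refine sInf_le ⟨γ, 1, fun i => if i = 0 then a else b, ⟨?_, ?_, ?_, ?_, ?_⟩, ?_⟩
  · intro i hi
    obtain rfl : i = 0 := by omega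
    simpa using hab
  · intro i hi
    obtain rfl : i = 0 := by omega
    simpa using hγ
  · simpa using hW
  · simp
  · simp
  · simp

theorem IsPiecewise.mono {W' : Set X} {p q : X} {γ : ℝ → X} {m : ℕ} {s : ℕ → ℝ}
    (H : IsPiecewise Seg W p q γ m s) (hW : ∀ t ∈ Icc (s 0) (s m), γ t ∈ W') :
    IsPiecewise Seg W' p q γ m s :=
  ⟨H.lt_succ, H.seg, hW, H.start, H.finish⟩

theorem IsPiecewise.Icc_subset {p q : X} {γ : ℝ → X} {m : ℕ} {s : ℕ → ℝ}
    (H : IsPiecewise Seg W p q γ m s) {i : ℕ} (hi : i < m) :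
    Icc (s i) (s (i + 1)) ⊆ Icc (s 0) (s m) :=
  Icc_subset_Icc (H.le (Nat.zero_le _) hi.le) (H.le hi le_rfl)

/-- A function satisfying the triangle inequality, which is bounded above by the length on
each segment, is bounded above along piecewise paths. -/
theorem IsPiecewise.le_sum {D : X → X → ℝ≥0∞} (D_self : ∀ p, D p p = 0)
    (D_triangle : ∀ p q r, D p r ≤ D p q + D q r)
    {p q : X} {γ : ℝ → X} {m : ℕ} {s : ℕ → ℝ} (H : IsPiecewise Seg W p q γ m s)
    (hD : ∀ i < m, D (γ (s i)) (γ (s (i + 1))) ≤ len γ (s i) (s (i + 1))) {k : ℕ} (hk : k ≤ m) :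
    D p (γ (s k)) ≤ ∑ i ∈ Finset.range k, len γ (s i) (s (i + 1)) := by
  induction k with
  | zero => rw [H.start, D_self]; exact bot_le
  | succ k ih =>
    rw [Finset.sum_range_succ]
    exact (D_triangle _ _ _).trans (add_le_add (ih (by omega)) (hD k (by omega)))

/-- The induced distance is the largest function with the triangle inequality that lies below the
length of each segment. All lower bounds come from this. So does the horizontal upper bound, where
`D` is itself a rescaled spacetime distance and the segments lie in `S`. -/
theorem le_curveEDist {D : X → X → ℝ≥0∞} (D_self : ∀ p, D p p = 0)
    (D_triangle : ∀ p q r, D p r ≤ D p q + D q r)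
    (hD : ∀ (γ : ℝ → X) (a b : ℝ), a < b → Seg γ a b → (∀ t ∈ Icc a b, γ t ∈ W) →
      D (γ a) (γ b) ≤ len γ a b) (p q : X) :
    D p q ≤ curveEDist Seg len W p q := by
  refine le_sInf ?_
  rintro L ⟨γ, m, s, H, rfl⟩
  have := H.le_sum (len := len) D_self D_triangle (fun i hi => hD _ _ _ (H.lt_succ i hi) (H.seg i hi)
    fun t ht => H.mem t (H.Icc_subset hi ht)) le_rfl
  rwa [H.finish] at this

/-- The length of a piecewise path bounds the distance from its start to each of its points. -/
theorem IsPiecewise.le_sum_of_mem {D : X → X → ℝ≥0∞} (D_self : ∀ p, D p p = 0)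
    (D_triangle : ∀ p q r, D p r ≤ D p q + D q r)
    {p q : X} {γ : ℝ → X} {m : ℕ} {s : ℕ → ℝ} (H : IsPiecewise Seg W p q γ m s)
    (hD : ∀ i < m, ∀ t ∈ Icc (s i) (s (i + 1)), D (γ (s i)) (γ t) ≤ len γ (s i) (s (i + 1)))
    {t : ℝ} (ht : t ∈ Icc (s 0) (s m)) :
    D p (γ t) ≤ ∑ i ∈ Finset.range m, len γ (s i) (s (i + 1)) := by
  have key : ∀ k ≤ m, ∀ t ∈ Icc (s 0) (s k),
      D p (γ t) ≤ ∑ i ∈ Finset.range k, len γ (s i) (s (i + 1)) := by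
    intro k hk
    induction k with
    | zero =>
      intro t ht
      rw [Icc_self, mem_singleton_iff] at ht
      rw [ht, H.start, D_self]; exact bot_le
    | succ k ih =>
      intro t ht
      rw [Finset.sum_range_succ]
      rcases le_total t (s k) with h | h
      · exact (ih (by omega) t ⟨ht.1, h⟩).trans le_self_add
      · refine (D_triangle _ (γ (s k)) _).trans (add_le_add ?_ (hD k (by omega) t ⟨h, ht.2⟩))
        exact ih (by omega) _ ⟨H.le (Nat.zero_le _) (by omega), le_rfl⟩
  exact key m le_rfl t ht

end LengthStructures

/-! ### The Riemannian distance of the spatial manifold -/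

section Spatial

open scoped Bundle

variable {n : ℕ} {S : Type*} [TopologicalSpace S] [ChartedSpace (EuclideanSpace ℝ (Fin n)) S]
  [IsManifold (𝓡 n) ∞ S] (h : SpatialMetric n S)

/-- The norm of the velocity of a curve in `S`. -/
noncomputable def speed (α : ℝ → S) (a b s : ℝ) : ℝ :=
  √(h.inner (α s) (velocity (𝓡 n) α a b s) (velocity (𝓡 n) α a b s))

variable {h}

theorem speed_nonneg (α : ℝ → S) (a b s : ℝ) : 0 ≤ speed h α a b s :=
  Real.sqrt_nonneg _

theorem SpatialMetric.inner_self_nonneg (x : S) (v : TangentSpace (𝓡 n) x) : 0 ≤ h.inner x v v := by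
  by_cases hv : v = 0
  · simp [hv]
  · exact (h.pos x v hv).le

theorem speed_const {x : S} {a b s : ℝ} : speed h (fun _ => x) a b s = 0 := by
  have : velocity (𝓡 n) (fun _ : ℝ => x) a b s = 0 := by
    rw [velocity, mfderivWithin_const]; rfl
  rw [speed, this]
  simp

theorem SmoothSeg.continuousOn_speed {α : ℝ → S} {a b : ℝ} (hab : a < b)
    (hα : SmoothSeg (𝓡 n) α a b) : ContinuousOn (speed h α a b) (Icc a b) := by
  let _ : Bundle.RiemannianBundle (fun x : S => TangentSpace (𝓡 n) x) := ⟨h.toRiemannianMetric⟩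
  have _ : IsContinuousRiemannianBundle (EuclideanSpace ℝ (Fin n))
    (fun x : S => TangentSpace (𝓡 n) x) := ⟨h.inner, h.contMDiff.continuous, fun _ _ _ => rfl⟩
  have hu : UniqueMDiffOn 𝓘(ℝ, ℝ) (Icc a b) :=
    uniqueMDiffOn_iff_uniqueDiffOn.2 (uniqueDiffOn_Icc hab)
  have h1 := ContMDiffOn.continuousOn_tangentMapWithin hα (by simp) hu
  -- The lifted velocity is the tangent map of `α` applied to the constant unit vector field on the
  -- interval, hence continuous into the tangent bundle.
  have h2 : ContinuousOn (fun s : ℝ => (⟨s, (1 : ℝ)⟩ : TangentBundle 𝓘(ℝ, ℝ) ℝ)) (Icc a b) := by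
    apply Continuous.continuousOn
    exact (tangentBundleModelSpaceHomeomorph 𝓘(ℝ, ℝ)).symm.continuous.comp
      (continuous_id.prodMk continuous_const)
  have h3 := h1.comp h2 (fun s hs => by simpa using hs)
  have h4 : ContinuousOn (fun s => (⟨α s, velocity (𝓡 n) α a b s⟩ : TangentBundle (𝓡 n) S))
    (Icc a b) := h3
  exact (ContinuousOn.inner_bundle h4 h4).sqrt

theorem arcLength_eq_ofReal {α : ℝ → S} {a b : ℝ} (hab : a < b) (hα : SmoothSeg (𝓡 n) α a b) :
    arcLength (𝓡 n) (fun x v => h.inner x v v) α a b =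
      ENNReal.ofReal (∫ s in a..b, speed h α a b s) := by
  have hc := hα.continuousOn_speed (h := h) hab
  rw [intervalIntegral.integral_of_le hab.le, ← integral_Icc_eq_integral_Ioc,
    ofReal_integral_eq_lintegral_ofReal (hc.integrableOn_Icc)
      (Eventually.of_forall fun s => speed_nonneg α a b s)]
  rfl

theorem spatialDist_le_arcLength {α : ℝ → S} {a b : ℝ} (hab : a < b)
    (hα : SmoothSeg (𝓡 n) α a b) :
    spatialDist h (α a) (α b) ≤ arcLength (𝓡 n) (fun x v => h.inner x v v) α a b :=
  curveEDist_le_len (Seg := SmoothSeg (𝓡 n)) hab hα (by simp)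

theorem spatialDist_self (x : S) : spatialDist h x x = 0 :=
  curveEDist_self (mem_univ _)

theorem spatial_isLengthClass :
    IsLengthClass (SmoothSeg (𝓡 n) (N := S)) (arcLength (𝓡 n) (fun x v => h.inner x v v)) :=
  isLengthClass_smooth (fun p v => by simp)

theorem spatialDist_comm (x y : S) : spatialDist h x y = spatialDist h y x :=
  curveEDist_comm spatial_isLengthClass _ _

theorem spatialDist_triangle (x y z : S) :
    spatialDist h x z ≤ spatialDist h x y + spatialDist h y z :=
  curveEDist_triangle spatial_isLengthClass _ _ _

/-- In a chart, a point near `x` is reached by a straight segment inside a ball contained in the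
chart's target. Its preimage is a smooth curve, and smooth segments have finite length. -/
theorem eventually_spatialDist_lt_top (x : S) : ∀ᶠ y in 𝓝 x, spatialDist h x y < ⊤ := by
  have ht := extChartAt_target_mem_nhds (I := 𝓡 n) x
  obtain ⟨r, r_pos, hr⟩ := Metric.mem_nhds_iff.1 ht
  filter_upwards [(continuousAt_extChartAt (I := 𝓡 n) x).preimage_mem_nhds
    (Metric.ball_mem_nhds _ r_pos), extChartAt_source_mem_nhds (I := 𝓡 n) x] with y hy hys
  set η : ℝ → EuclideanSpace ℝ (Fin n) :=
    ⇑(AffineMap.lineMap (k := ℝ) (extChartAt (𝓡 n) x x) (extChartAt (𝓡 n) x y)) with hη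
  have hm : MapsTo η (Icc 0 1) (extChartAt (𝓡 n) x).target := by
    intro t htt
    refine hr ((convex_ball _ r).segment_subset (Metric.mem_ball_self r_pos) hy ?_)
    rw [segment_eq_image_lineMap]
    exact mem_image_of_mem _ htt
  have hs : SmoothSeg (𝓡 n) ((extChartAt (𝓡 n) x).symm ∘ η) 0 1 := by
    refine (contMDiffOn_extChartAt_symm x).comp (ContMDiff.contMDiffOn ?_) hm
    rw [contMDiff_iff_contDiff]
    exact (ContinuousAffineMap.lineMap (R := ℝ) (extChartAt (𝓡 n) x x)
      (extChartAt (𝓡 n) x y)).contDiff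
  have := spatialDist_le_arcLength (h := h) zero_lt_one hs
  rw [arcLength_eq_ofReal zero_lt_one hs] at this
  simp only [Function.comp_apply, hη, AffineMap.lineMap_apply_zero, AffineMap.lineMap_apply_one,
    extChartAt_to_inv, (extChartAt (𝓡 n) x).left_inv hys] at this
  exact this.trans_lt ENNReal.ofReal_lt_top

/-- Being at finite distance is an equivalence relation with open classes, so the classes are
clopen. -/
theorem spatialDist_lt_top [ConnectedSpace S] (x y : S) : spatialDist h x y < ⊤ := by
  have hc : IsClopen {y | spatialDist h x y < ⊤} := by
    refine ⟨⟨?_⟩, ?_⟩ <;> rw [isOpen_iff_mem_nhds] <;> intro y hy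
    · filter_upwards [eventually_spatialDist_lt_top (h := h) y] with z hz hxz
      rw [spatialDist_comm] at hz
      exact hy ((spatialDist_triangle x z y).trans_lt (ENNReal.add_lt_top.2 ⟨hxz, hz⟩))
    · filter_upwards [eventually_spatialDist_lt_top (h := h) y] with z hz
      exact (spatialDist_triangle x y z).trans_lt (ENNReal.add_lt_top.2 ⟨hy, hz⟩)
  have := hc.eq_univ ⟨x, by simp [spatialDist_self]⟩
  exact (Set.eq_univ_iff_forall.1 this) y

/-- `riemannianEDist` is bounded by the length of each smooth segment, hence by `spatialDist`. It
separates points because its small balls around `x` avoid the closed point `y`. -/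
theorem spatialDist_pos [T2Space S] {x y : S} (hxy : x ≠ y) : 0 < spatialDist h x y := by
  let _ : Bundle.RiemannianBundle (fun x : S => TangentSpace (𝓡 n) x) := ⟨h.toRiemannianMetric⟩
  have _ : IsContinuousRiemannianBundle (EuclideanSpace ℝ (Fin n))
    (fun x : S => TangentSpace (𝓡 n) x) := ⟨h.inner, h.contMDiff.continuous, fun _ _ _ => rfl⟩
  have _ : LocallyCompactSpace S := Manifold.locallyCompact_of_finiteDimensional (𝓡 n)
  obtain ⟨c, c_pos, hc⟩ := setOfPred_riemannianEDist_lt_subset_nhds' (𝓡 n)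
    (isOpen_compl_singleton.mem_nhds hxy)
  have h1 : c ≤ riemannianEDist (𝓡 n) x y := by
    by_contra hlt
    exact hc (not_le.1 hlt) rfl
  refine c_pos.trans_le (h1.trans (le_curveEDist (D := riemannianEDist (𝓡 n))
    (fun _ => riemannianEDist_self) (fun _ _ _ => riemannianEDist_triangle) ?_ x y))
  intro γ a b hab hγ _
  refine (riemannianEDist_le_pathELength (hγ.of_le (by simp)) rfl rfl hab.le).trans_eq ?_
  rw [pathELength_eq_lintegral_mfderivWithin_Icc]
  refine setLIntegral_congr_fun measurableSet_Icc fun s _ => ?_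
  rw [← ofReal_norm, norm_eq_sqrt_real_inner]
  rfl

end Spatial

/-! ### Curves in the product -/

section Product

variable {n : ℕ} {S : Type*} [TopologicalSpace S] [ChartedSpace (EuclideanSpace ℝ (Fin n)) S]
  {γ : ℝ → ℝ × S} {a b s : ℝ}

theorem SmoothSeg.fst (hγ : SmoothSeg (grwModel n) γ a b) :
    ContDiffOn ℝ ∞ (fun s => (γ s).1) (Icc a b) := by
  rw [← contMDiffOn_iff_contDiffOn]
  exact ContMDiff.comp_contMDiffOn (I' := grwModel n) contMDiff_fst hγ

theorem SmoothSeg.snd (hγ : SmoothSeg (grwModel n) γ a b) :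
    SmoothSeg (𝓡 n) (fun s => (γ s).2) a b :=
  ContMDiff.comp_contMDiffOn (I' := grwModel n) contMDiff_snd hγ

theorem dTime_velocity (hab : a < b) (hγ : SmoothSeg (grwModel n) γ a b) (hs : s ∈ Icc a b) :
    dTime (γ s) (velocity (grwModel n) γ a b s) =
      derivWithin (fun s => (γ s).1) (Icc a b) s := by
  have hu : UniqueMDiffWithinAt 𝓘(ℝ, ℝ) (Icc a b) s :=
    uniqueMDiffWithinAt_iff_uniqueDiffWithinAt.2 (uniqueDiffOn_Icc hab s hs)
  have h1 := mfderiv_comp_mfderivWithin (I' := grwModel n) (I'' := 𝓘(ℝ, ℝ))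
    (g := (Prod.fst : ℝ × S → ℝ)) s mdifferentiableAt_fst
    (hγ.mdifferentiableOn (by simp) s hs) hu
  rw [← fderivWithin_derivWithin, ← mfderivWithin_eq_fderivWithin]
  exact (congrArg (fun T : ℝ →L[ℝ] ℝ => T 1) h1).symm

theorem dSpace_velocity (hab : a < b) (hγ : SmoothSeg (grwModel n) γ a b) (hs : s ∈ Icc a b) :
    dSpace (γ s) (velocity (grwModel n) γ a b s) =
      velocity (𝓡 n) (fun s => (γ s).2) a b s := by
  have hu : UniqueMDiffWithinAt 𝓘(ℝ, ℝ) (Icc a b) s :=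
    uniqueMDiffWithinAt_iff_uniqueDiffWithinAt.2 (uniqueDiffOn_Icc hab s hs)
  have h1 := mfderiv_comp_mfderivWithin (I' := grwModel n) (I'' := 𝓡 n)
    (g := (Prod.snd : ℝ × S → S)) s mdifferentiableAt_snd
    (hγ.mdifferentiableOn (by simp) s hs) hu
  exact (congrArg (fun T : ℝ →L[ℝ] EuclideanSpace ℝ (Fin n) => T 1) h1).symm

variable [IsManifold (𝓡 n) ∞ S] {h : SpatialMetric n S} {f : ℝ → ℝ}

theorem speed_sq (α : ℝ → S) (a b s : ℝ) : speed h α a b s ^ 2 =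
    h.inner (α s) (velocity (𝓡 n) α a b s) (velocity (𝓡 n) α a b s) :=
  Real.sq_sqrt (SpatialMetric.inner_self_nonneg _ _)

theorem lorentzMetric_velocity (hab : a < b) (hγ : SmoothSeg (grwModel n) γ a b)
    (hs : s ∈ Icc a b) :
    lorentzMetric h f (γ s) (velocity (grwModel n) γ a b s) (velocity (grwModel n) γ a b s) =
      -derivWithin (fun s => (γ s).1) (Icc a b) s ^ 2 +
        (f (γ s).1 * speed h (fun s => (γ s).2) a b s) ^ 2 := by
  rw [lorentzMetric, dTime_velocity hab hγ hs, dSpace_velocity hab hγ hs, mul_pow, speed_sq]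
  ring

theorem riemMetric_velocity (hab : a < b) (hγ : SmoothSeg (grwModel n) γ a b)
    (hs : s ∈ Icc a b) :
    riemMetric h f (γ s) (velocity (grwModel n) γ a b s) (velocity (grwModel n) γ a b s) =
      derivWithin (fun s => (γ s).1) (Icc a b) s ^ 2 +
        (f (γ s).1 * speed h (fun s => (γ s).2) a b s) ^ 2 := by
  rw [riemMetric, lorentzMetric_velocity hab hγ hs, dTime_velocity hab hγ hs]
  ring

theorem riemLength_eq (hab : a < b) (hγ : SmoothSeg (grwModel n) γ a b) :
    riemLength h f γ a b = ∫⁻ s in Icc a b,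
      ENNReal.ofReal √(derivWithin (fun s => (γ s).1) (Icc a b) s ^ 2 +
        (f (γ s).1 * speed h (fun s => (γ s).2) a b s) ^ 2) := by
  refine setLIntegral_congr_fun measurableSet_Icc fun s hs => ?_
  simp only [riemMetric_velocity hab hγ hs]

/-! ### Lower bounds for lengths -/

theorem lintegral_ofReal_derivWithin {u : ℝ → ℝ} (hab : a < b) (hu : ContDiffOn ℝ ∞ u (Icc a b))
    (h0 : ∀ s ∈ Icc a b, 0 ≤ derivWithin u (Icc a b) s) :
    ∫⁻ s in Icc a b, ENNReal.ofReal (derivWithin u (Icc a b) s) = ENNReal.ofReal (u b - u a) := by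
  have hc : ContinuousOn (derivWithin u (Icc a b)) (Icc a b) :=
    hu.continuousOn_derivWithin (uniqueDiffOn_Icc hab) (by simp)
  rw [← ofReal_integral_eq_lintegral_ofReal hc.integrableOn_Icc
    ((ae_restrict_mem measurableSet_Icc).mono h0), integral_Icc_eq_integral_Ioc,
    ← intervalIntegral.integral_of_le hab.le]
  congr 1
  refine intervalIntegral.integral_eq_sub_of_hasDerivAt_of_le hab.le hu.continuousOn ?_ ?_
  · intro s hs
    have := ((hu.differentiableOn (by simp)) s (Ioo_subset_Icc_self hs)).hasDerivWithinAt
    exact this.hasDerivAt (Icc_mem_nhds hs.1 hs.2)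
  · exact (hc.mono (by rw [uIcc_of_le hab.le])).intervalIntegrable

/-- In coordinates, `g(γ', γ') ≤ 0` says that `|f|` times the spatial speed is at most `|t'|`. The
sign of `t'` is fixed on the whole segment. On a constant segment both sides vanish, so it fits the
first alternative. -/
theorem CausalSeg.dichotomy (hab : a < b) (hγ : CausalSeg h f γ a b) :
    (∀ s ∈ Icc a b, 0 ≤ derivWithin (fun s => (γ s).1) (Icc a b) s ∧
      |f (γ s).1| * speed h (fun s => (γ s).2) a b s ≤
        derivWithin (fun s => (γ s).1) (Icc a b) s) ∨
    (∀ s ∈ Icc a b, 0 ≤ derivWithin (fun s => -(γ s).1) (Icc a b) s ∧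
      |f (γ s).1| * speed h (fun s => (γ s).2) a b s ≤
        derivWithin (fun s => -(γ s).1) (Icc a b) s) := by
  have key : ∀ s, |f (γ s).1| * speed h (fun s => (γ s).2) a b s =
      |f (γ s).1 * speed h (fun s => (γ s).2) a b s| := fun s => by
    rw [abs_mul, abs_of_nonneg (speed_nonneg _ _ _ _)]
  rcases hγ.2 with H | H | H
  · refine Or.inl fun s hs => ?_
    obtain ⟨h1, h2⟩ := H s hs
    rw [lorentzMetric_velocity hab hγ.1 hs] at h1
    rw [dTime_velocity hab hγ.1 hs] at h2
    rw [key]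
    exact ⟨h2.le, abs_le_of_sq_le_sq (by linarith) h2.le⟩
  · refine Or.inr fun s hs => ?_
    obtain ⟨h1, h2⟩ := H s hs
    rw [lorentzMetric_neg, lorentzMetric_velocity hab hγ.1 hs] at h1
    rw [dTime_neg, dTime_velocity hab hγ.1 hs] at h2
    have e : derivWithin (fun s => -(γ s).1) (Icc a b) s =
      -derivWithin (fun s => (γ s).1) (Icc a b) s := derivWithin.fun_neg
    rw [key, e]
    refine ⟨h2.le, abs_le_of_sq_le_sq (by rw [neg_sq]; linarith) h2.le⟩
  · have hr : ∀ s ∈ Icc a b, γ s = γ a := fun s hs => H s hs a (left_mem_Icc.2 hab.le)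
    refine Or.inl fun s hs => ?_
    have e1 : derivWithin (fun s => (γ s).1) (Icc a b) s = 0 := by
      rw [derivWithin_congr (f := fun _ => (γ a).1) (fun s hs => by simp only [hr s hs])
        (by simp only [hr s hs])]
      simp
    have e2 : speed h (fun s => (γ s).2) a b s = 0 := by
      have := velocity_congr (I := 𝓡 n) (γ := fun _ => (γ a).2) (γ' := fun s => (γ s).2)
        (fun p v => √(h.inner p v v)) (a := a) (b := b) (fun s hs => by simp only [hr s hs]) hs
      exact this.trans speed_const
    rw [e1, e2]
    simp

theorem CausalSeg.monotoneOn_or_antitoneOn (hab : a < b) (hγ : CausalSeg h f γ a b) :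
    MonotoneOn (fun s => (γ s).1) (Icc a b) ∨ AntitoneOn (fun s => (γ s).1) (Icc a b) := by
  have hmono : ∀ u : ℝ → ℝ, ContDiffOn ℝ ∞ u (Icc a b) →
      (∀ s ∈ Icc a b, 0 ≤ derivWithin u (Icc a b) s) → MonotoneOn u (Icc a b) := by
    intro u hu h0
    refine monotoneOn_of_deriv_nonneg (convex_Icc a b) hu.continuousOn
      ((hu.differentiableOn (by simp)).mono interior_subset) fun s hs => ?_
    have := h0 s (interior_subset hs)
    rwa [derivWithin_of_mem_nhds (mem_interior_iff_mem_nhds.1 hs)] at this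
  rcases hγ.dichotomy hab with H | H
  · exact Or.inl (hmono _ hγ.1.fst fun s hs => (H s hs).1)
  · refine Or.inr fun x hx y hy hxy => ?_
    have := hmono _ hγ.1.fst.neg (fun s hs => (H s hs).1) hx hy hxy
    simpa using this

theorem DistKind.smoothSeg {Z : DistKind} (hγ : Z.Seg h f γ a b) :
    SmoothSeg (grwModel n) γ a b := by
  cases Z
  · exact hγ
  · exact hγ.1
  · exact hγ.1

/-- The length of a segment bounds the time elapsed from its start to any of its points. -/
theorem DistKind.ofReal_abs_sub_le_len {Z : DistKind} (hab : a < b) (hγ : Z.Seg h f γ a b)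
    (hs : s ∈ Icc a b) : ENNReal.ofReal |(γ s).1 - (γ a).1| ≤ Z.len h f γ a b := by
  have hriem : SmoothSeg (grwModel n) γ a b →
      ENNReal.ofReal |(γ s).1 - (γ a).1| ≤ riemLength h f γ a b := by
    intro hγ
    rcases hs.1.eq_or_lt with rfl | has
    · simp
    rw [riemLength_eq hab hγ]
    have h1 := enorm_sub_le_lintegral_derivWithin_Icc_of_contDiffOn_Icc (f := fun s => (γ s).1)
      ((hγ.fst.of_le (by simp)).mono (Icc_subset_Icc_right hs.2)) has.le
    rw [Real.enorm_eq_ofReal_abs] at h1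
    refine h1.trans ?_
    -- The time derivative relative to `[a, s]` agrees with the one relative to `[a, b]`, which the
    -- Riemannian speed dominates pointwise.
    have h2 : ∫⁻ t in Icc a s, ‖derivWithin (fun s => (γ s).1) (Icc a s) t‖ₑ =
        ∫⁻ t in Icc a s, ‖derivWithin (fun s => (γ s).1) (Icc a b) t‖ₑ := by
      refine setLIntegral_congr_fun measurableSet_Icc fun t ht => ?_
      rw [derivWithin_subset (Icc_subset_Icc_right hs.2) (uniqueDiffOn_Icc has t ht)
        (hγ.fst.differentiableOn (by simp) t ⟨ht.1, ht.2.trans hs.2⟩)]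
    rw [h2]
    refine (lintegral_mono_set (Icc_subset_Icc_right hs.2)).trans (lintegral_mono fun t => ?_)
    rw [Real.enorm_eq_ofReal_abs]
    refine ENNReal.ofReal_le_ofReal (Real.abs_le_sqrt ?_)
    nlinarith [sq_nonneg (f (γ t).1 * speed h (fun s => (γ s).2) a b t)]
  cases Z
  · exact hriem hγ
  · refine ENNReal.ofReal_le_ofReal ?_
    have ha := left_mem_Icc.2 hab.le
    have hb := right_mem_Icc.2 hab.le
    -- Null length only sees the endpoints; monotonicity of time puts the intermediate value between
    -- theirs.
    rcases CausalSeg.monotoneOn_or_antitoneOn hab hγ with H | H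
    · have h1 := H ha hs hs.1
      have h2 := H hs hb hs.2
      simp only at h1 h2
      rw [abs_of_nonneg (by linarith), abs_of_nonneg (by linarith)]
      linarith
    · have h1 := H ha hs hs.1
      have h2 := H hs hb hs.2
      simp only at h1 h2
      rw [abs_of_nonpos (by linarith), abs_of_nonpos (by linarith)]
      linarith
  · exact hriem hγ.1

/-- The length of the projection to `S`, scaled by `c`, is at most the integral of `f` times the
spatial speed. That integrand is below the Riemannian speed, and for causal segments below the
signed time derivative, which integrates to the null length. -/
theorem DistKind.mul_spatialDist_le_len {Z : DistKind} {c : ℝ} (hc : 0 ≤ c) (hab : a < b)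
    (hγ : Z.Seg h f γ a b) (hf : ∀ s ∈ Icc a b, c ≤ f (γ s).1) :
    ENNReal.ofReal c * spatialDist h (γ a).2 (γ b).2 ≤ Z.len h f γ a b := by
  have h0 : ENNReal.ofReal c * spatialDist h (γ a).2 (γ b).2 ≤
      ∫⁻ s in Icc a b, ENNReal.ofReal (f (γ s).1 * speed h (fun s => (γ s).2) a b s) := by
    refine (mul_le_mul_right (spatialDist_le_arcLength hab
      (DistKind.smoothSeg hγ).snd) (ENNReal.ofReal c)).trans ?_
    rw [arcLength, ← lintegral_const_mul' _ _ ENNReal.ofReal_ne_top]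
    refine setLIntegral_mono' measurableSet_Icc fun s hs => ?_
    rw [← ENNReal.ofReal_mul hc]
    exact ENNReal.ofReal_le_ofReal (mul_le_mul_of_nonneg_right (hf s hs) (Real.sqrt_nonneg _))
  refine h0.trans ?_
  have hriem : SmoothSeg (grwModel n) γ a b →
      ∫⁻ s in Icc a b, ENNReal.ofReal (f (γ s).1 * speed h (fun s => (γ s).2) a b s) ≤
        riemLength h f γ a b := by
    intro hγ
    rw [riemLength_eq hab hγ]
    refine lintegral_mono fun s => ENNReal.ofReal_le_ofReal (Real.le_sqrt_of_sq_le ?_)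
    nlinarith [sq_nonneg (derivWithin (fun s => (γ s).1) (Icc a b) s)]
  cases Z
  · exact hriem hγ
  · rcases CausalSeg.dichotomy hab hγ with H | H
    · refine (setLIntegral_mono' measurableSet_Icc fun s hs => ENNReal.ofReal_le_ofReal
        ((mul_le_mul_of_nonneg_right (le_abs_self _) (speed_nonneg _ _ _ _)).trans
          (H s hs).2)).trans ?_
      rw [lintegral_ofReal_derivWithin hab hγ.1.fst fun s hs => (H s hs).1]
      exact ENNReal.ofReal_le_ofReal (le_abs_self _)
    · refine (setLIntegral_mono' measurableSet_Icc fun s hs => ENNReal.ofReal_le_ofReal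
        ((mul_le_mul_of_nonneg_right (le_abs_self _) (speed_nonneg _ _ _ _)).trans
          (H s hs).2)).trans ?_
      rw [lintegral_ofReal_derivWithin hab hγ.1.fst.neg fun s hs => (H s hs).1]
      refine ENNReal.ofReal_le_ofReal ?_
      rw [neg_sub_neg, ← neg_sub]
      exact neg_le_abs _
  · exact hriem hγ.1

/-! ### Lower bounds for the distances -/

variable {Z : DistKind} {W : Set (ℝ × S)}

theorem ofReal_abs_triangle (x y z : ℝ) :
    ENNReal.ofReal |z - x| ≤ ENNReal.ofReal |y - x| + ENNReal.ofReal |z - y| := by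
  rw [← ENNReal.ofReal_add (abs_nonneg _) (abs_nonneg _)]
  refine ENNReal.ofReal_le_ofReal ?_
  rw [add_comm]
  exact abs_sub_le z y x

/-- The time function is 1-Lipschitz. -/
theorem ofReal_abs_sub_le_grwDist (p q : ℝ × S) :
    ENNReal.ofReal |q.1 - p.1| ≤ grwDist h f Z W p q :=
  le_curveEDist (D := fun p q => ENNReal.ofReal |q.1 - p.1|) (by simp)
    (fun _ _ _ => ofReal_abs_triangle _ _ _)
    (fun _ _ _ hab hγ _ => DistKind.ofReal_abs_sub_le_len hab hγ (right_mem_Icc.2 hab.le)) p q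

theorem mul_spatialDist_le_grwDist {c : ℝ} (hc : 0 ≤ c) (hf : ∀ p ∈ W, c ≤ f p.1)
    (p q : ℝ × S) : ENNReal.ofReal c * spatialDist h p.2 q.2 ≤ grwDist h f Z W p q := by
  refine le_curveEDist (D := fun p q : ℝ × S => ENNReal.ofReal c * spatialDist h p.2 q.2)
    (by simp [spatialDist_self]) (fun p q r => ?_)
    (fun γ a b hab hγ hW => DistKind.mul_spatialDist_le_len hc hab hγ fun s hs => hf _ (hW s hs))
    p q
  rw [← mul_add]
  exact mul_le_mul_right (spatialDist_triangle _ _ _) _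

/-- A curve in `W` either stays below the level `δ` or is at least as long as the time needed to
reach it. -/
theorem min_le_grwDist {c δ : ℝ} (hc : 0 ≤ c) (hf : ∀ p ∈ W, p.1 < δ → c ≤ f p.1)
    (p q : ℝ × S) :
    min (ENNReal.ofReal c * spatialDist h p.2 q.2) (ENNReal.ofReal (δ - p.1)) ≤
      grwDist h f Z W p q := by
  refine le_sInf ?_
  rintro L ⟨γ, m, s, H, rfl⟩
  by_cases hlt : ∀ t ∈ Icc (s 0) (s m), (γ t).1 < δ
  -- The curve is admissible in the smaller set `W ∩ {p | p.1 < δ}`, where `f ≥ c` everywhere.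
  · refine (min_le_left _ _).trans ((mul_spatialDist_le_grwDist (Z := Z)
      (W := W ∩ {p | p.1 < δ}) hc (fun p hp => hf p hp.1 hp.2) p q).trans ?_)
    exact sInf_le ⟨γ, m, s, H.mono fun t ht => ⟨H.mem t ht, hlt t ht⟩, rfl⟩
  · push Not at hlt
    obtain ⟨t, ht, hδ⟩ := hlt
    refine (min_le_right _ _).trans ?_
    have := H.le_sum_of_mem (len := Z.len h f) (D := fun p q => ENNReal.ofReal |q.1 - p.1|)
      (by simp) (fun _ _ _ => ofReal_abs_triangle _ _ _)
      (fun i hi t ht => DistKind.ofReal_abs_sub_le_len (H.lt_succ i hi) (H.seg i hi) ht) ht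
    refine le_trans (ENNReal.ofReal_le_ofReal ?_) this
    exact (sub_le_sub_right hδ _).trans (le_abs_self _)

end Product

/-! ### Upper bounds for distances -/

section Slab

variable {S : Type*}

theorem eventually_mem_slab {r : ℝ} {u v : EReal} (hu : u < r) (hv : (r : EReal) < v) :
    ∀ᶠ t : ℝ in 𝓝 r, ∀ x : S, (t, x) ∈ slab S u v := by
  filter_upwards [continuous_coe_real_ereal.continuousAt.eventually_const_lt hu,
    continuous_coe_real_ereal.continuousAt.eventually_lt_const hv] with t h1 h2 x
  exact ⟨h1, h2⟩

theorem mem_slab_of_mem_uIcc {u v : EReal} {p q : ℝ × S} (hp : p ∈ slab S u v)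
    (hq : q ∈ slab S u v) {t : ℝ} (ht : t ∈ uIcc p.1 q.1) (x : S) : (t, x) ∈ slab S u v := by
  rcases le_total p.1 q.1 with hpq | hpq
  · rw [uIcc_of_le hpq] at ht
    exact ⟨hp.1.trans_le (EReal.coe_le_coe_iff.2 ht.1),
      (EReal.coe_le_coe_iff.2 ht.2).trans_lt hq.2⟩
  · rw [uIcc_of_ge hpq] at ht
    exact ⟨hq.1.trans_le (EReal.coe_le_coe_iff.2 ht.1),
      (EReal.coe_le_coe_iff.2 ht.2).trans_lt hp.2⟩

end Slab

section UpperBounds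

variable {n : ℕ} {S : Type*} [TopologicalSpace S] [ChartedSpace (EuclideanSpace ℝ (Fin n)) S]
  {α : ℝ → S} {a b r e : ℝ}

/-- One family covers all test curves: vertical (`α` constant, `e = 1`), horizontal (`e = 0`) and
the two legs of a zigzag (`e = ± c`). -/
theorem SmoothSeg.slant (hα : SmoothSeg (𝓡 n) α a b) (r e : ℝ) :
    SmoothSeg (grwModel n) (fun s => (r + e * s, α s)) a b := by
  refine ContMDiffOn.prodMk (f := fun s : ℝ => r + e * s) ?_ hα
  rw [contMDiffOn_iff_contDiffOn]
  fun_prop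

theorem derivWithin_affine (hab : a < b) {s : ℝ} (hs : s ∈ Icc a b) :
    derivWithin (fun s => r + e * s) (Icc a b) s = e := by
  have := ((hasDerivAt_id s).const_mul e).const_add r
  rw [mul_one] at this
  exact this.hasDerivWithinAt.derivWithin (uniqueDiffOn_Icc hab s hs)

theorem SmoothSeg.mono {a' b' : ℝ} (hα : SmoothSeg (𝓡 n) α a b) (hs : Icc a' b' ⊆ Icc a b) :
    SmoothSeg (𝓡 n) α a' b' :=
  ContMDiffOn.mono hα hs

variable [IsManifold (𝓡 n) ∞ S] {h : SpatialMetric n S} {f : ℝ → ℝ} {Z : DistKind}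
  {W : Set (ℝ × S)}

theorem speed_eq_of_subset {a' b' s : ℝ} (hα : SmoothSeg (𝓡 n) α a b) (hab : a' < b')
    (hsub : Icc a' b' ⊆ Icc a b) (hs : s ∈ Icc a' b') :
    speed h α a' b' s = speed h α a b s := by
  have hu : UniqueMDiffWithinAt 𝓘(ℝ, ℝ) (Icc a' b') s :=
    uniqueMDiffWithinAt_iff_uniqueDiffWithinAt.2 (uniqueDiffOn_Icc hab s hs)
  have : velocity (𝓡 n) α a' b' s = velocity (𝓡 n) α a b s := by
    rw [velocity, velocity, mfderivWithin_subset hsub hu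
      (hα.mdifferentiableOn (by simp) s (hsub hs))]
  rw [speed, speed, this]

theorem causalSeg_slant (hab : a < b) (hα : SmoothSeg (𝓡 n) α a b) (he : e ≠ 0)
    (H : ∀ s ∈ Icc a b, (f (r + e * s) * speed h α a b s) ^ 2 ≤ e ^ 2) :
    CausalSeg h f (fun s => (r + e * s, α s)) a b := by
  have hγ := hα.slant r e
  have h1 : ∀ s ∈ Icc a b, lorentzMetric h f (r + e * s, α s)
      (velocity (grwModel n) (fun s => (r + e * s, α s)) a b s)
      (velocity (grwModel n) (fun s => (r + e * s, α s)) a b s) ≤ 0 := by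
    intro s hs
    rw [lorentzMetric_velocity hab hγ hs, derivWithin_affine hab hs]
    linarith [H s hs]
  refine ⟨hγ, ?_⟩
  rcases he.lt_or_gt with he | he
  · refine Or.inr (Or.inl fun s hs => ⟨?_, ?_⟩)
    · rw [lorentzMetric_neg]
      exact h1 s hs
    · rw [dTime_neg, dTime_velocity hab hγ hs, derivWithin_affine hab hs]
      exact neg_pos.2 he
  · refine Or.inl fun s hs => ⟨h1 s hs, ?_⟩
    rw [dTime_velocity hab hγ hs, derivWithin_affine hab hs]
    exact he

theorem riemLength_horizontal (hr : 0 ≤ f r) (hab : a < b) (hα : SmoothSeg (𝓡 n) α a b) :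
    riemLength h f (fun s => (r, α s)) a b =
      ENNReal.ofReal (f r) * arcLength (𝓡 n) (fun x v => h.inner x v v) α a b := by
  have hγ := hα.slant r 0
  simp only [zero_mul, add_zero] at hγ
  rw [riemLength_eq hab hγ, arcLength, ← lintegral_const_mul' _ _ ENNReal.ofReal_ne_top]
  refine setLIntegral_congr_fun measurableSet_Icc fun s hs => ?_
  rw [← ENNReal.ofReal_mul hr]
  have : derivWithin (fun _ : ℝ => r) (Icc a b) s = 0 := congrFun (derivWithin_const _ _) s
  simp only [this]
  rw [zero_pow two_ne_zero, zero_add, Real.sqrt_sq (mul_nonneg hr (speed_nonneg _ _ _ _))]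
  rfl

theorem grwDist_self {p : ℝ × S} (hp : p ∈ W) : grwDist h f Z W p p = 0 :=
  curveEDist_self hp

theorem grwDist_comm (p q : ℝ × S) : grwDist h f Z W p q = grwDist h f Z W q p :=
  curveEDist_comm Z.isLengthClass p q

theorem grwDist_triangle (p q r : ℝ × S) :
    grwDist h f Z W p r ≤ grwDist h f Z W p q + grwDist h f Z W q r :=
  curveEDist_triangle Z.isLengthClass p q r

/-! ### Vertical and horizontal moves -/

theorem grwDist_vertical_le (x : S) {t s : ℝ} (hW : ∀ r ∈ uIcc t s, (r, x) ∈ W) :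
    grwDist h f Z W (t, x) (s, x) ≤ ENNReal.ofReal |s - t| := by
  wlog hts : t ≤ s generalizing t s
  · rw [grwDist_comm, abs_sub_comm]
    exact this (by rwa [uIcc_comm]) (le_of_not_ge hts)
  rcases hts.eq_or_lt with rfl | hts
  · rw [grwDist_self (hW t (by simp))]
    exact bot_le
  rw [uIcc_of_le hts.le] at hW
  have hα : SmoothSeg (𝓡 n) (fun _ => x) t s := contMDiffOn_const
  have hγ := hα.slant 0 1
  have hlen : riemLength h f (fun r => (0 + 1 * r, x)) t s = ENNReal.ofReal |s - t| := by
    rw [riemLength_eq hts hγ]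
    have : ∀ r ∈ Icc t s, ENNReal.ofReal √(derivWithin (fun s : ℝ => 0 + 1 * s) (Icc t s) r ^ 2 +
        (f (0 + 1 * r) * speed h (fun _ => x) t s r) ^ 2) = 1 := by
      intro r hr
      rw [derivWithin_affine hts hr, speed_const]
      simp
    rw [setLIntegral_congr_fun measurableSet_Icc this]
    simp [abs_of_pos (sub_pos.2 hts)]
  have key : Z.Seg h f (fun r => (0 + 1 * r, x)) t s ∧
      Z.len h f (fun r => (0 + 1 * r, x)) t s = ENNReal.ofReal |s - t| := by
    cases Z
    · exact ⟨hγ, hlen⟩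
    · exact ⟨causalSeg_slant hts hα one_ne_zero (by simp [speed_const]),
        by simp [DistKind.len, nullLength]⟩
    · exact ⟨⟨hγ, Or.inl fun _ _ _ _ => rfl⟩, hlen⟩
  have := curveEDist_le_len (Seg := Z.Seg h f) (len := Z.len h f) (W := W) hts key.1
    (by simpa using hW)
  rw [key.2] at this
  simp only [zero_add, one_mul] at this
  exact this

/-- A zigzag made of two null segments, along a spatial curve of almost constant speed. -/
theorem grwDist_zigzag_le {c : ℝ} (hc : 0 < c) (hab : a < b) (hα : SmoothSeg (𝓡 n) α a b)
    (hW : ∀ t ∈ Icc r (r + c * (b - a)), ∀ x, (t, x) ∈ W)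
    (H : ∀ t ∈ Icc r (r + c * (b - a)), ∀ s ∈ Icc a b, (f t * speed h α a b s) ^ 2 ≤ c ^ 2) :
    grwDist h f .N W (r, α a) (r, α b) ≤ ENNReal.ofReal (c * (b - a)) := by
  -- Time rises with slope `c` up to the midpoint and falls back with slope `-c`. The peak is `r + c
  -- * (b - a) / 2`, within the window on which `H` and `hW` are assumed.
  set m : ℝ := (a + b) / 2 with hm
  have ham : a < m := by linarith
  have hmb : m < b := by linarith
  have s1 : Icc a m ⊆ Icc a b := Icc_subset_Icc_right hmb.le
  have s2 : Icc m b ⊆ Icc a b := Icc_subset_Icc_left ham.le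
  have m1 : ∀ s ∈ Icc a m, r - c * a + c * s ∈ Icc r (r + c * (b - a)) := fun s hs =>
    ⟨by nlinarith [hs.1], by nlinarith [hs.2]⟩
  have m2 : ∀ s ∈ Icc m b, r + c * b + -c * s ∈ Icc r (r + c * (b - a)) := fun s hs =>
    ⟨by nlinarith [hs.2], by nlinarith [hs.1]⟩
  have c1 : CausalSeg h f (fun s => (r - c * a + c * s, α s)) a m := by
    refine causalSeg_slant ham (hα.mono s1) hc.ne' fun s hs => ?_
    rw [speed_eq_of_subset hα ham s1 hs]
    exact H _ (m1 s hs) s (s1 hs)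
  have c2 : CausalSeg h f (fun s => (r + c * b + -c * s, α s)) m b := by
    refine causalSeg_slant hmb (hα.mono s2) (neg_ne_zero.2 hc.ne') fun s hs => ?_
    rw [speed_eq_of_subset hα hmb s2 hs, neg_sq]
    exact H _ (m2 s hs) s (s2 hs)
  have d1 := curveEDist_le_len (Seg := CausalSeg h f) (len := nullLength) (W := W) ham c1
    (fun s hs => hW _ (m1 s hs) _)
  have d2 := curveEDist_le_len (Seg := CausalSeg h f) (len := nullLength) (W := W) hmb c2
    (fun s hs => hW _ (m2 s hs) _)
  have e1 : r - c * a + c * a = r := by ring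
  have e2 : r + c * b + -c * b = r := by ring
  have e3 : r + c * b + -c * m = r - c * a + c * m := by rw [hm]; ring
  have p : 0 < c * (b - a) := mul_pos hc (sub_pos.2 hab)
  have l1 : |r - c * a + c * m - r| = c * (b - a) / 2 := by
    rw [abs_of_nonneg] <;> rw [hm] <;> nlinarith
  have l2 : |r - (r - c * a + c * m)| = c * (b - a) / 2 := by
    rw [abs_sub_comm, l1]
  simp only [nullLength, e1, e2, e3, l1, l2] at d1 d2
  refine (grwDist_triangle (Z := .N) _ (r - c * a + c * m, α m) _).trans
    ((add_le_add d1 d2).trans_eq ?_)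
  rw [← ENNReal.ofReal_add (by positivity) (by positivity)]
  congr 1
  ring

/-- On a short interval the speed is almost constant, and a zigzag stays so near the level `r` that
`f` is almost `f r`; hence a zigzag of nearly optimal slope is causal. The threshold `δ` is uniform,
so the bounds can be added over a partition. -/
theorem grwDist_null_le_of_lt (hr : 0 < f r) (hfr : ContinuousAt f r)
    (hW : ∀ᶠ t in 𝓝 r, ∀ x, (t, x) ∈ W) (hab : a < b) (hα : SmoothSeg (𝓡 n) α a b)
    {ε : ℝ} (hε : 0 < ε) : ∃ δ > 0, ∀ x z, a ≤ x → x < z → z ≤ b → z - x < δ →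
      grwDist h f .N W (r, α x) (r, α z) ≤
        ENNReal.ofReal ((1 + ε) * f r * ∫ s in x..z, (speed h α a b s + 2 * ε)) := by
  have hv := hα.continuousOn_speed (h := h) hab
  obtain ⟨K, hK⟩ := (isCompact_Icc.image_of_continuousOn hv).bddAbove
  have hK0 : 0 ≤ K := (speed_nonneg α a b a).trans
    (hK (mem_image_of_mem _ (left_mem_Icc.2 hab.le)))
  have hlt : ∀ᶠ t in 𝓝 r, 0 < f t ∧ f t < (1 + ε) * f r :=
    (hfr.eventually_const_lt hr).and (hfr.eventually_lt_const (by nlinarith))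
  obtain ⟨η, η_pos, hη⟩ := Metric.eventually_nhds_iff.1 (hW.and hlt)
  obtain ⟨δ, δ_pos, hδ⟩ := Metric.uniformContinuousOn_iff.1
    (isCompact_Icc.uniformContinuousOn_of_continuous hv) ε hε
  have hC : 0 < (1 + ε) * f r * (K + ε) := by positivity
  -- The first term controls the oscillation of the speed; the second keeps the climb below `η`,
  -- since `K` bounds the speed and so every slope used.
  refine ⟨min δ (η / ((1 + ε) * f r * (K + ε))), lt_min δ_pos (by positivity), ?_⟩
  intro x z hax hxz hzb hlt
  have hsub : Icc x z ⊆ Icc a b := Icc_subset_Icc hax hzb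
  have hx : x ∈ Icc a b := hsub (left_mem_Icc.2 hxz.le)
  have hvx : ∀ s ∈ Icc x z, |speed h α a b x - speed h α a b s| < ε := fun s hs =>
    hδ x hx s (hsub hs) (by
      rw [Real.dist_eq, abs_sub_comm, abs_of_nonneg (sub_nonneg.2 hs.1)]
      linarith [hlt.trans_le (min_le_left _ _), hs.2])
  have hvx0 := speed_nonneg (h := h) α a b x
  have hvxK : speed h α a b x ≤ K := hK (mem_image_of_mem _ hx)
  -- The slope exceeds `f t` times the speed throughout the interval. Replacing the speed at `x` by
  -- that at `s` costs another `ε`, whence the `2 * ε` in the integrand.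
  set c : ℝ := (1 + ε) * f r * (speed h α a b x + ε) with hcdef
  have hc : 0 < c := by positivity
  have hcη : c * (z - x) < η := by
    have h1 := hlt.trans_le (min_le_right _ _)
    rw [lt_div_iff₀ hC] at h1
    have h2 : c ≤ (1 + ε) * f r * (K + ε) := by
      rw [hcdef]; gcongr
    nlinarith [mul_le_mul_of_nonneg_right h2 (sub_nonneg.2 hxz.le)]
  have hnear : ∀ t ∈ Icc r (r + c * (z - x)), dist t r < η := fun t ht => by
    rw [Real.dist_eq, abs_of_nonneg (sub_nonneg.2 ht.1)]
    linarith [ht.2]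
  refine (grwDist_zigzag_le hc hxz (hα.mono hsub) (fun t ht => (hη (hnear t ht)).1) ?_).trans ?_
  · intro t ht s hs
    obtain ⟨h1, h2⟩ := (hη (hnear t ht)).2
    rw [speed_eq_of_subset hα hxz hsub hs]
    have h3 := speed_nonneg (h := h) α a b s
    have h4 := (abs_lt.1 (hvx s hs)).1
    have h5 : f t * speed h α a b s ≤ c :=
      mul_le_mul h2.le (by linarith) h3 (by positivity)
    exact pow_le_pow_left₀ (by positivity) h5 2
  · refine ENNReal.ofReal_le_ofReal ?_
    rw [hcdef, mul_assoc]
    refine mul_le_mul_of_nonneg_left ?_ (by positivity)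
    have h1 : ∫ _ in x..z, (speed h α a b x + ε) = (speed h α a b x + ε) * (z - x) := by
      rw [intervalIntegral.integral_const, smul_eq_mul, mul_comm]
    rw [← h1]
    refine intervalIntegral.integral_mono_on hxz.le intervalIntegrable_const ?_ ?_
    · refine ContinuousOn.intervalIntegrable ?_
      rw [uIcc_of_le hxz.le]
      exact (hv.mono hsub).add continuousOn_const
    · intro s hs
      linarith [(abs_lt.1 (hvx s hs)).2]

/-- A horizontal curve is not causal unless constant, so it is replaced by a chain of zigzags over a
fine partition. The errors disappear as `ε → 0`. -/
theorem grwDist_null_horizontal_le (hr : 0 < f r) (hfr : ContinuousAt f r)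
    (hW : ∀ᶠ t in 𝓝 r, ∀ x, (t, x) ∈ W) (hab : a < b) (hα : SmoothSeg (𝓡 n) α a b) :
    grwDist h f .N W (r, α a) (r, α b) ≤
      ENNReal.ofReal (f r) * arcLength (𝓡 n) (fun x v => h.inner x v v) α a b := by
  have hv := hα.continuousOn_speed (h := h) hab
  have hint : ∀ (ε : ℝ) {x z : ℝ}, x ∈ Icc a b → z ∈ Icc a b →
      IntervalIntegrable (fun s => speed h α a b s + 2 * ε) volume x z := fun ε x z hx hz =>
    ((hv.add continuousOn_const).mono ((convex_Icc a b).ordConnected.uIcc_subset hx hz)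
      ).intervalIntegrable
  have main : ∀ ε > 0, grwDist h f .N W (r, α a) (r, α b) ≤
      ENNReal.ofReal ((1 + ε) * f r * ∫ s in a..b, (speed h α a b s + 2 * ε)) := by
    intro ε hε
    obtain ⟨δ, δ_pos, hδ⟩ := grwDist_null_le_of_lt (h := h) (W := W) hr hfr hW hab hα hε
    obtain ⟨N, hN⟩ := exists_nat_gt ((b - a) / δ)
    have hN0 : (0 : ℝ) < N := lt_of_le_of_lt (div_nonneg (by linarith) δ_pos.le) hN
    have hstep : (b - a) / N < δ := by
      rw [div_lt_iff₀ δ_pos] at hN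
      rw [div_lt_iff₀ hN0]
      linarith
    have hstep0 : 0 < (b - a) / N := div_pos (sub_pos.2 hab) hN0
    set p : ℕ → ℝ := fun i => a + i * ((b - a) / N) with hp
    have hpN : p N = b := by simp only [hp]; field_simp; ring
    have hp0 : p 0 = a := by simp [hp]
    have hps : ∀ i, p (i + 1) = p i + (b - a) / N := fun i => by simp only [hp]; push_cast; ring
    have hpm : Monotone p := monotone_nat_of_le_succ fun i => by rw [hps]; linarith
    have hpI : ∀ i ≤ N, p i ∈ Icc a b := fun i hi =>
      ⟨hp0.symm.trans_le (hpm (Nat.zero_le i)), (hpm hi).trans_eq hpN⟩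
    have key : ∀ i ≤ N, grwDist h f .N W (r, α a) (r, α (p i)) ≤
        ENNReal.ofReal ((1 + ε) * f r * ∫ s in a..p i, (speed h α a b s + 2 * ε)) := by
      intro i
      induction i with
      | zero =>
        intro _
        rw [hp0, grwDist_self (hW.self_of_nhds _)]
        exact bot_le
      | succ i ih =>
        intro hi
        have hi' : i ≤ N := by omega
        refine (grwDist_triangle _ (r, α (p i)) _).trans ((add_le_add (ih hi')
          (hδ _ _ (hpI i hi').1 (by rw [hps]; linarith) (hpI _ hi).2
            (by rw [hps]; linarith))).trans_eq ?_)
        have h0 : ∀ {x z : ℝ}, x ≤ z →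
            0 ≤ (1 + ε) * f r * ∫ s in x..z, (speed h α a b s + 2 * ε) := fun hxz =>
          mul_nonneg (by positivity) (intervalIntegral.integral_nonneg hxz fun s _ =>
            add_nonneg (speed_nonneg _ _ _ _) (by positivity))
        rw [← ENNReal.ofReal_add (h0 (hpI i hi').1) (h0 (hpm (Nat.le_succ i))), ← mul_add,
          intervalIntegral.integral_add_adjacent_intervals
            (hint ε (left_mem_Icc.2 hab.le) (hpI i hi')) (hint ε (hpI i hi') (hpI _ hi))]
    have := key N le_rfl
    rwa [hpN] at this
  have hvi : IntervalIntegrable (speed h α a b) volume a b := by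
    simpa using hint 0 (left_mem_Icc.2 hab.le) (right_mem_Icc.2 hab.le)
  rw [arcLength_eq_ofReal hab hα, ← ENNReal.ofReal_mul hr.le]
  have hlim : Tendsto (fun ε : ℝ => ENNReal.ofReal ((1 + ε) * f r *
      ((∫ s in a..b, speed h α a b s) + (b - a) * (2 * ε)))) (𝓝[>] 0)
      (𝓝 (ENNReal.ofReal ((1 + 0) * f r *
        ((∫ s in a..b, speed h α a b s) + (b - a) * (2 * 0))))) := by
    refine (ENNReal.continuous_ofReal.comp (by fun_prop)).continuousAt.tendsto.mono_left
      nhdsWithin_le_nhds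
  simp only [add_zero, one_mul, mul_zero] at hlim
  refine ge_of_tendsto hlim ?_
  filter_upwards [self_mem_nhdsWithin] with ε hε
  refine (main ε hε).trans_eq ?_
  rw [intervalIntegral.integral_add hvi intervalIntegrable_const,
    intervalIntegral.integral_const, smul_eq_mul]

/-- The distance at level `r` divided by `f r` is compared with `d_S` on each spatial segment. `W`
must contain a whole neighbourhood of the level because zigzags leave it. -/
theorem grwDist_horizontal_le (hr : 0 < f r) (hfr : ContinuousAt f r)
    (hW : ∀ᶠ t in 𝓝 r, ∀ x, (t, x) ∈ W) (x y : S) :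
    grwDist h f Z W (r, x) (r, y) ≤ ENNReal.ofReal (f r) * spatialDist h x y := by
  have hr0 : ENNReal.ofReal (f r) ≠ 0 := by simpa using hr
  rw [← ENNReal.inv_mul_le_iff hr0 ENNReal.ofReal_ne_top]
  refine le_curveEDist (Seg := SmoothSeg (𝓡 n))
    (D := fun x y => (ENNReal.ofReal (f r))⁻¹ * grwDist h f Z W (r, x) (r, y))
    (fun x => by rw [grwDist_self (hW.self_of_nhds x), mul_zero]) (fun x y z => ?_) ?_ x y
  · rw [← mul_add]
    exact mul_le_mul_right (grwDist_triangle _ _ _) _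
  · intro α a b hab hα _
    rw [ENNReal.inv_mul_le_iff hr0 ENNReal.ofReal_ne_top]
    have hγ := hα.slant r 0
    simp only [zero_mul, add_zero] at hγ
    cases Z
    · refine (curveEDist_le_len (Seg := SmoothSeg (grwModel n)) (len := riemLength h f) hab hγ
        (fun s _ => hW.self_of_nhds _)).trans_eq (riemLength_horizontal hr.le hab hα)
    · exact grwDist_null_horizontal_le hr hfr hW hab hα
    · refine (curveEDist_le_len (Seg := VertHorizSeg n) (len := riemLength h f) hab
        ⟨hγ, Or.inr fun _ _ _ _ => rfl⟩
        (fun s _ => hW.self_of_nhds _)).trans_eq (riemLength_horizontal hr.le hab hα)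

/-- Any two points of a slab are joined by a path that moves vertically, then along the level `r`,
and then vertically. -/
theorem grwDist_slab_le {u v : EReal} (hu : u < r) (hv : (r : EReal) < v) (hr : 0 < f r)
    (hfr : ContinuousAt f r) {p q : ℝ × S} (hp : p ∈ slab S u v) (hq : q ∈ slab S u v) :
    grwDist h f Z (slab S u v) p q ≤ ENNReal.ofReal |r - p.1| +
      ENNReal.ofReal (f r) * spatialDist h p.2 q.2 + ENNReal.ofReal |q.1 - r| := by
  have hmem := fun x : S => (eventually_mem_slab (S := S) hu hv).self_of_nhds x
  refine (grwDist_triangle p (r, q.2) q).trans (add_le_add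
    ((grwDist_triangle p (r, p.2) _).trans (add_le_add ?_ ?_)) ?_)
  · exact grwDist_vertical_le p.2 fun t ht => mem_slab_of_mem_uIcc hp (hmem p.2) ht _
  · exact grwDist_horizontal_le hr hfr (eventually_mem_slab hu hv) _ _
  · exact grwDist_vertical_le q.2 fun t ht => mem_slab_of_mem_uIcc (hmem p.2) hq ht _

end UpperBounds

/-! ### The completion -/

section Completion

variable {n : ℕ} {S : Type*} [TopologicalSpace S] [ChartedSpace (EuclideanSpace ℝ (Fin n)) S]
  [IsManifold (𝓡 n) ∞ S] {h : SpatialMetric n S} {f : ℝ → ℝ} {b : EReal} {Z : DistKind}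

/-- The point `(t, x)` of `M`. -/
def GRWSpace.point {t : ℝ} (ht : 0 < t ∧ (t : EReal) < b) (x : S) : GRWSpace h f b Z :=
  ⟨(t, x), EReal.coe_pos.2 ht.1, ht.2⟩

theorem GRWSpace.lipschitzWith_time :
    LipschitzWith 1 (GRWSpace.time : GRWSpace h f b Z → ℝ) := fun p q => by
  rw [ENNReal.coe_one, one_mul, edist_dist, Real.dist_eq, abs_sub_comm]
  exact ofReal_abs_sub_le_grwDist _ _

theorem existsUnique_continuous_extension_time :
    ∃! τ : GRWCompletion h f b Z → ℝ, Continuous τ ∧ ∀ p : GRWSpace h f b Z, τ p = p.time := by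
  have hu := (GRWSpace.lipschitzWith_time (h := h) (f := f) (b := b) (Z := Z)).uniformContinuous
  refine ⟨UniformSpace.Completion.extension GRWSpace.time,
    ⟨UniformSpace.Completion.continuous_extension,
      fun p => UniformSpace.Completion.extension_coe hu p⟩, fun τ hτ => ?_⟩
  refine UniformSpace.Completion.ext hτ.1 UniformSpace.Completion.continuous_extension fun p => ?_
  rw [hτ.2, UniformSpace.Completion.extension_coe hu]

/-- The vertical line through `x` converges in the completion as `t → 0`. -/
theorem exists_tendsto_vertical {t : ℕ → ℝ} (ht : ∀ k, 0 < t k ∧ (t k : EReal) < b)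
    (ht0 : Tendsto t atTop (𝓝 0)) (x : S) :
    ∃ P : GRWCompletion h f b Z, Tendsto (fun k => ((GRWSpace.point (ht k) x :
      GRWSpace h f b Z) : GRWCompletion h f b Z)) atTop (𝓝 P) := by
  set p : ℕ → GRWSpace h f b Z := fun k => GRWSpace.point (ht k) x with hp
  refine cauchySeq_tendsto_of_complete ((UniformSpace.Completion.uniformContinuous_coe _).comp_cauchySeq
    (u := p) ?_)
  rw [EMetric.cauchySeq_iff]
  intro ε hε
  obtain ⟨N, hN⟩ := EMetric.cauchySeq_iff.1 ht0.cauchySeq ε hε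
  refine ⟨N, fun i hi j hj => ?_⟩
  refine lt_of_le_of_lt ?_ (hN i hi j hj)
  rw [edist_dist, Real.dist_eq, abs_sub_comm]
  exact grwDist_vertical_le x fun r hr => mem_slab_of_mem_uIcc (p i).2 (p j).2 hr x

theorem eventually_lt_of_pos (hb : 0 < b) : ∀ᶠ t : ℝ in 𝓝[>] 0, 0 < t ∧ (t : EReal) < b := by
  have hb' : ((0 : ℝ) : EReal) < b := by simpa using hb
  filter_upwards [self_mem_nhdsWithin, nhdsWithin_le_nhds
    (continuous_coe_real_ereal.continuousAt.eventually_lt_const hb')] with t h1 h2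
  exact ⟨h1, h2⟩

theorem exists_seq_tendsto_zero (hb : 0 < b) :
    ∃ t : ℕ → ℝ, (∀ k, 0 < t k ∧ (t k : EReal) < b) ∧ Tendsto t atTop (𝓝 0) := by
  obtain ⟨t, ht, H⟩ := exists_seq_forall_of_frequently (eventually_lt_of_pos hb).frequently
  exact ⟨t, H, ht.mono_right nhdsWithin_le_nhds⟩

theorem continuousAt_of_contDiffOn (hf : ContDiffOn ℝ ∞ f {t : ℝ | 0 < t ∧ (t : EReal) < b})
    {r : ℝ} (hr : 0 < r) (hrb : (r : EReal) < b) : ContinuousAt f r := by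
  refine hf.continuousOn.continuousAt ?_
  filter_upwards [eventually_gt_nhds hr,
    continuous_coe_real_ereal.continuousAt.eventually_lt_const hrb] with t h1 h2
  exact ⟨h1, h2⟩

/-! ### Big bang point and pinching along a sequence -/

theorem grwDist_le_grwDiam {W V : Set (ℝ × S)} {p q : ℝ × S} (hp : p ∈ V) (hq : q ∈ V) :
    grwDist h f Z W p q ≤ grwDiam h f Z W V :=
  le_iSup₂_of_le p hp (le_iSup₂_of_le q hq le_rfl)

/-- For fixed `p` and `q`, passing through the level `t k` costs at most `2s` vertically and `f (t
k) * d_S` horizontally. The latter tends to zero because `d_S` is finite, and the remaining bound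
does not depend on the points, even if `S` is unbounded. -/
theorem grwDiam_le_of_tendsto [ConnectedSpace S]
    (hf : ContDiffOn ℝ ∞ f {t : ℝ | 0 < t ∧ (t : EReal) < b})
    (hf_pos : ∀ t : ℝ, 0 < t → (t : EReal) < b → 0 < f t) {t : ℕ → ℝ}
    (ht : ∀ k, 0 < t k ∧ (t k : EReal) < b) (ht0 : Tendsto t atTop (𝓝 0))
    (hft : Tendsto (fun k => f (t k)) atTop (𝓝 0)) {s : ℝ} (hs : 0 < s) (hsb : (s : EReal) < b) :
    grwDiam h f Z (slab S 0 b) (slab S 0 s) ≤ ENNReal.ofReal s + ENNReal.ofReal s := by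
  refine iSup₂_le fun p hp => iSup₂_le fun q hq => ?_
  have hd : spatialDist h p.2 q.2 ≠ ⊤ := (spatialDist_lt_top _ _).ne
  have hlim : Tendsto (fun k => ENNReal.ofReal s + ENNReal.ofReal (f (t k)) *
      spatialDist h p.2 q.2 + ENNReal.ofReal s) atTop
      (𝓝 (ENNReal.ofReal s + ENNReal.ofReal 0 * spatialDist h p.2 q.2 + ENNReal.ofReal s)) :=
    (tendsto_const_nhds.add (ENNReal.Tendsto.mul_const (ENNReal.tendsto_ofReal hft)
      (Or.inr hd))).add tendsto_const_nhds
  rw [ENNReal.ofReal_zero, zero_mul, add_zero] at hlim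
  refine ge_of_tendsto hlim ?_
  filter_upwards [ht0.eventually_lt_const hs] with k hk
  have hlt : ∀ {z : ℝ × S}, z ∈ slab S 0 s → 0 < z.1 ∧ z.1 < s := fun hz =>
    ⟨EReal.coe_pos.1 hz.1, EReal.coe_lt_coe_iff.1 hz.2⟩
  refine (grwDist_slab_le (EReal.coe_pos.2 (ht k).1) (ht k).2 (hf_pos _ (ht k).1 (ht k).2)
    (continuousAt_of_contDiffOn hf (ht k).1 (ht k).2) ⟨hp.1, hp.2.trans hsb⟩
    ⟨hq.1, hq.2.trans hsb⟩).trans ?_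
  gcongr
  · rw [abs_le]
    constructor <;> linarith [(hlt hp).1, (hlt hp).2, (ht k).1]
  · rw [abs_le]
    constructor <;> linarith [(hlt hq).1, (hlt hq).2, (ht k).1]

/-- Every point over time zero is a limit of points of `M_t`, for each `t > 0`. Two such points
therefore lie in a common closed entourage of any size. -/
theorem eq_of_tendsto_grwDiam (hb : 0 < b)
    (hdiam : Tendsto (fun t : ℝ => grwDiam h f Z (slab S 0 b) (slab S 0 t)) (𝓝[>] 0) (𝓝 0))
    {τ : GRWCompletion h f b Z → ℝ} (hτ : Continuous τ)
    (hτt : ∀ p : GRWSpace h f b Z, τ p = p.time) {P Q : GRWCompletion h f b Z}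
    (hP : τ P = 0) (hQ : τ Q = 0) : P = Q := by
  refine eq_of_uniformity_basis uniformity_hasBasis_closed fun {V} hV => ?_
  have hV' : {pq : GRWSpace h f b Z × GRWSpace h f b Z |
      ((pq.1 : GRWCompletion h f b Z), (pq.2 : GRWCompletion h f b Z)) ∈ V} ∈
      uniformity (GRWSpace h f b Z) :=
    UniformSpace.Completion.uniformContinuous_coe _ hV.1
  obtain ⟨ε, hε, H⟩ := mem_uniformity_edist.1 hV'
  obtain ⟨t, ht, ht0, -⟩ := ((hdiam.eventually_lt_const hε).and (eventually_lt_of_pos hb)).exists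
  have hcl : ∀ R : GRWCompletion h f b Z, τ R = 0 →
      R ∈ closure ((↑) '' {p : GRWSpace h f b Z | p.time < t}) := by
    intro R hR
    have ho : IsOpen {R | τ R < t} := isOpen_lt hτ continuous_const
    have := UniformSpace.Completion.denseRange_coe.open_subset_closure_inter ho
      -- The open set `{τ < t}` contains `R`, so density of `M` makes `R` a limit of points of `M`
      -- in that set.
      (show R ∈ {R | τ R < t} by simpa [hR] using ht0)
    refine closure_mono ?_ this
    rintro _ ⟨hlt, p, rfl⟩
    exact ⟨p, by simpa [hτt] using hlt, rfl⟩
  have hPQ : (P, Q) ∈ closure (((↑) '' {p : GRWSpace h f b Z | p.time < t}) ×ˢ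
      ((↑) '' {p : GRWSpace h f b Z | p.time < t}) :
        Set (GRWCompletion h f b Z × GRWCompletion h f b Z)) := by
    rw [closure_prod_eq]
    exact ⟨hcl P hP, hcl Q hQ⟩
  refine closure_minimal ?_ hV.2 hPQ
  rintro ⟨_, _⟩ ⟨⟨p, hp, rfl⟩, ⟨q, hq, rfl⟩⟩
  have hp' : p.1 ∈ slab S 0 t := ⟨p.2.1, EReal.coe_lt_coe_iff.2 hp⟩
  have hq' : q.1 ∈ slab S 0 t := ⟨q.2.1, EReal.coe_lt_coe_iff.2 hq⟩
  exact H ((grwDist_le_grwDiam hp' hq').trans_lt ht)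

/-- By contraposition: if no such sequence exists, `f` is bounded below near zero, and vertical
lines over two distinct points keep a positive distance although both must converge to `p₀`. -/
theorem exists_seq_of_existsUnique [T2Space S] [Nontrivial S] (hb : 0 < b)
    {τ : GRWCompletion h f b Z → ℝ} (hτ : Continuous τ)
    (hτt : ∀ p : GRWSpace h f b Z, τ p = p.time) {p₀ : GRWCompletion h f b Z}
    (hp₀ : τ ⁻¹' {0} = {p₀}) (hf_pos : ∀ t : ℝ, 0 < t → (t : EReal) < b → 0 < f t) :
    ∃ t : ℕ → ℝ, (∀ k, 0 < t k ∧ (t k : EReal) < b) ∧ Tendsto t atTop (𝓝 0) ∧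
      Tendsto (fun k => f (t k)) atTop (𝓝 0) := by
  by_contra hne
  have hbound : ∃ ε > 0, ∀ᶠ t : ℝ in 𝓝[>] 0, ε ≤ f t := by
    by_contra! hcon
    have hfreq : ∀ k : ℕ, ∃ t : ℝ, (0 < t ∧ (t : EReal) < b) ∧ t < 1 / ((k : ℝ) + 1) ∧
        f t < 1 / ((k : ℝ) + 1) := by
      intro k
      have hk : 0 < 1 / ((k : ℝ) + 1) := Nat.one_div_pos_of_nat
      have h1 := hcon _ hk
      obtain ⟨t, ht, ht1, ht2⟩ := (h1.and_eventually ((eventually_lt_of_pos hb).and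
        (nhdsWithin_le_nhds (eventually_lt_nhds hk)))).exists
      exact ⟨t, ht1, ht2, ht⟩
    choose t ht1 ht2 ht3 using hfreq
    refine hne ⟨t, ht1, ?_, ?_⟩
    · exact squeeze_zero (fun k => (ht1 k).1.le) (fun k => (ht2 k).le)
        tendsto_one_div_add_atTop_nhds_zero_nat
    · exact squeeze_zero (fun k => (hf_pos _ (ht1 k).1 (ht1 k).2).le) (fun k => (ht3 k).le)
        tendsto_one_div_add_atTop_nhds_zero_nat
  obtain ⟨ε, hε, hev⟩ := hbound
  obtain ⟨δ, δ_pos, hδ⟩ := mem_nhdsGT_iff_exists_Ioo_subset.1 hev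
  rw [mem_Ioi] at δ_pos
  obtain ⟨x, y, hxy⟩ := exists_pair_ne S
  obtain ⟨t, ht, ht0⟩ := exists_seq_tendsto_zero hb
  have hlim : ∀ x : S, Tendsto (fun k => ((GRWSpace.point (ht k) x :
      GRWSpace h f b Z) : GRWCompletion h f b Z)) atTop (𝓝 p₀) := by
    intro x
    obtain ⟨P, hP⟩ := exists_tendsto_vertical (h := h) (f := f) (Z := Z) ht ht0 x
    have h1 := (hτ.tendsto P).comp hP
    have h2 : τ P = 0 := by
      refine tendsto_nhds_unique h1 (ht0.congr fun k => ?_)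
      exact (hτt (GRWSpace.point (ht k) x)).symm
    have h3 : P ∈ τ ⁻¹' {0} := h2
    rw [hp₀] at h3
    rwa [← mem_singleton_iff.1 h3]
  have hunif := ((hlim x).prodMk_nhds (hlim y)).mono_right (nhds_le_uniformity p₀)
  -- Once `t k < δ / 2`, climbing to the level `δ` takes at least `δ / 2`.
  have hd : 0 < min (ENNReal.ofReal ε * spatialDist h x y) (ENNReal.ofReal (δ / 2)) :=
    lt_min (ENNReal.mul_pos (by simpa using hε) (spatialDist_pos hxy).ne')
      (by simpa using δ_pos)
  have hmem := edist_mem_uniformity (α := GRWSpace h f b Z) hd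
  -- The entourage of small distances on `M` is pulled back from one of the completion, where both
  -- lines converge to the same point.
  rw [← UniformSpace.Completion.isUniformInducing_coe (GRWSpace h f b Z) |>.comap_uniformity]
    at hmem
  obtain ⟨V, hV, hVsub⟩ := mem_comap.1 hmem
  obtain ⟨k, hk, hkδ⟩ := ((hunif.eventually_mem hV).and
    (ht0.eventually_lt_const (half_pos δ_pos))).exists
  have hlt : grwDist h f Z (slab S 0 b) (t k, x) (t k, y) < _ :=
    @hVsub (GRWSpace.point (ht k) x, GRWSpace.point (ht k) y) hk
  refine absurd hlt (not_lt.2 ?_)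
  refine le_trans ?_ (min_le_grwDist (W := slab S 0 b) (c := ε) (δ := δ) hε.le
    (fun p hp hpδ => hδ ⟨EReal.coe_pos.1 hp.1, hpδ⟩) (t k, x) (t k, y))
  exact min_le_min le_rfl (ENNReal.ofReal_le_ofReal (by simp only; linarith))

end Completion

/-! ### Uniform pinching -/

section Uniform

variable {n : ℕ} {S : Type*} [TopologicalSpace S] [ChartedSpace (EuclideanSpace ℝ (Fin n)) S]
  [IsManifold (𝓡 n) ∞ S] {h : SpatialMetric n S} {f : ℝ → ℝ} {b : EReal} {Z : DistKind}

/-- The connecting level is taken inside the slab itself, so the path is intrinsic. Finite `diam S`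
bounds its horizontal part for all pairs at once. -/
theorem tendsto_iSup_grwDiam (hf : ContDiffOn ℝ ∞ f {t : ℝ | 0 < t ∧ (t : EReal) < b})
    (hf_pos : ∀ t : ℝ, 0 < t → (t : EReal) < b → 0 < f t) (hS : spatialDiam h < ⊤)
    (hf0 : Tendsto f (𝓝[>] 0) (𝓝 0)) :
    Tendsto (fun t : ℝ => ⨆ (u : ℝ) (v : ℝ) (_ : 0 ≤ u ∧ u < v ∧ v ≤ t ∧ (v : EReal) ≤ b),
      grwDiam h f Z (slab S u v) (slab S u v)) (𝓝[>] 0) (𝓝 0) := by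
  rw [ENNReal.tendsto_nhds_zero]
  intro ε hε
  have hlim : Tendsto (fun t : ℝ => ENNReal.ofReal t + ENNReal.ofReal (f t) * spatialDiam h +
      ENNReal.ofReal t) (𝓝[>] 0)
      (𝓝 (ENNReal.ofReal 0 + ENNReal.ofReal 0 * spatialDiam h + ENNReal.ofReal 0)) := by
    have h1 : Tendsto (fun t : ℝ => ENNReal.ofReal t) (𝓝[>] 0) (𝓝 (ENNReal.ofReal 0)) :=
      ENNReal.tendsto_ofReal (tendsto_id.mono_left nhdsWithin_le_nhds)
    exact (h1.add (ENNReal.Tendsto.mul_const (ENNReal.tendsto_ofReal hf0)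
      (Or.inr hS.ne))).add h1
  rw [ENNReal.ofReal_zero, zero_mul, add_zero, add_zero] at hlim
  -- A single `η` bounds both the width `t` of the slabs and the values of `f` on `(0, δ)`.
  have hη : ∃ η > 0, ENNReal.ofReal η + ENNReal.ofReal η * spatialDiam h +
      ENNReal.ofReal η ≤ ε := by
    have h1 : Tendsto (fun t : ℝ => ENNReal.ofReal t) (𝓝[>] 0) (𝓝 (ENNReal.ofReal 0)) :=
      ENNReal.tendsto_ofReal (tendsto_id.mono_left nhdsWithin_le_nhds)
    have h2 := (h1.add (ENNReal.Tendsto.mul_const h1 (Or.inr hS.ne))).add h1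
    rw [ENNReal.ofReal_zero, zero_mul, add_zero, add_zero] at h2
    obtain ⟨η, hle, hpos⟩ := ((ENNReal.tendsto_nhds_zero.1 h2 ε hε).and self_mem_nhdsWithin).exists
    exact ⟨η, hpos, hle⟩
  obtain ⟨η, η_pos, hη⟩ := hη
  obtain ⟨δ, δ_pos, hδ⟩ := mem_nhdsGT_iff_exists_Ioo_subset.1 (hf0.eventually_lt_const η_pos)
  rw [mem_Ioi] at δ_pos
  filter_upwards [nhdsWithin_le_nhds (eventually_lt_nhds δ_pos),
    nhdsWithin_le_nhds (eventually_lt_nhds η_pos)] with t htδ htη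
  refine iSup_le fun u => iSup_le fun v => iSup_le fun ⟨hu, huv, hvt, hvb⟩ => ?_
  refine iSup₂_le fun p hp => iSup₂_le fun q hq => ?_
  obtain ⟨r, hur, hrv⟩ := exists_between huv
  have hrb : (r : EReal) < b := (EReal.coe_lt_coe_iff.2 hrv).trans_le hvb
  have hr0 : 0 < r := hu.trans_lt hur
  refine (grwDist_slab_le (EReal.coe_lt_coe_iff.2 hur) (EReal.coe_lt_coe_iff.2 hrv)
    (hf_pos r hr0 hrb) (continuousAt_of_contDiffOn hf hr0 hrb) hp hq).trans (le_trans ?_ hη)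
  have hlt : ∀ {z : ℝ × S}, z ∈ slab S u v → u < z.1 ∧ z.1 < v := fun hz =>
    ⟨EReal.coe_lt_coe_iff.1 hz.1, EReal.coe_lt_coe_iff.1 hz.2⟩
  gcongr
  · rw [abs_le]
    constructor <;> linarith [(hlt hp).1, (hlt hp).2]
  · exact (hδ ⟨hr0, by linarith⟩ : f r < η).le
  · exact le_iSup₂_of_le p.2 q.2 le_rfl
  · rw [abs_le]
    constructor <;> linarith [(hlt hq).1, (hlt hq).2]

/-- If `f r ≥ η`, then `f > η / 2` on a thin slab around `r`. Curves trapped there pay `η / 2` times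
the distance of two fixed points of `S`, which small intrinsic diameters forbid. -/
theorem tendsto_of_tendsto_iSup_grwDiam [T2Space S] [Nontrivial S] (hb : 0 < b)
    (hf : ContDiffOn ℝ ∞ f {t : ℝ | 0 < t ∧ (t : EReal) < b})
    (hf_pos : ∀ t : ℝ, 0 < t → (t : EReal) < b → 0 < f t)
    (H : Tendsto (fun t : ℝ => ⨆ (u : ℝ) (v : ℝ) (_ : 0 ≤ u ∧ u < v ∧ v ≤ t ∧ (v : EReal) ≤ b),
      grwDiam h f Z (slab S u v) (slab S u v)) (𝓝[>] 0) (𝓝 0)) :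
    Tendsto f (𝓝[>] 0) (𝓝 0) := by
  obtain ⟨x, y, hxy⟩ := exists_pair_ne S
  rw [Metric.tendsto_nhds]
  intro η hη
  have hd : 0 < ENNReal.ofReal (η / 2) * spatialDist h x y :=
    ENNReal.mul_pos (by simpa using hη) (spatialDist_pos hxy).ne'
  obtain ⟨t, hsup, ht, -⟩ := ((H.eventually_lt_const hd).and (eventually_lt_of_pos hb)).exists
  filter_upwards [eventually_lt_of_pos hb, nhdsWithin_le_nhds (eventually_lt_nhds ht)]
    with r ⟨hr0, hrb⟩ hrt
  rw [Real.dist_eq, sub_zero, abs_of_pos (hf_pos r hr0 hrb)]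
  by_contra! hle
  have hev : ∀ᶠ s : ℝ in 𝓝 r, 0 < s ∧ s < t ∧ (s : EReal) < b ∧ η / 2 < f s := by
    filter_upwards [eventually_gt_nhds hr0, eventually_lt_nhds hrt,
      continuous_coe_real_ereal.continuousAt.eventually_lt_const hrb,
      (continuousAt_of_contDiffOn hf hr0 hrb).eventually_const_lt
        (show η / 2 < f r by linarith)] with s h1 h2 h3 h4
    exact ⟨h1, h2, h3, h4⟩
  -- The slab used has half-width `κ / 2`, so its closed ends also satisfy the constraints `0 ≤ u`,
  -- `v ≤ t` and `v ≤ b`.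
  obtain ⟨κ, κ_pos, hκ⟩ := Metric.eventually_nhds_iff.1 hev
  have hdist : ∀ s, r - κ / 2 ≤ s → s ≤ r + κ / 2 → dist s r < κ := fun s h1 h2 => by
    rw [Real.dist_eq, abs_lt]
    constructor <;> linarith
  have hu := hκ (hdist (r - κ / 2) le_rfl (by linarith))
  have hv := hκ (hdist (r + κ / 2) (by linarith) le_rfl)
  have hmem : ∀ x : S, (r, x) ∈ slab S ((r - κ / 2 : ℝ) : EReal) ((r + κ / 2 : ℝ) : EReal) :=
    fun x => ⟨EReal.coe_lt_coe_iff.2 (by simp only; linarith),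
      EReal.coe_lt_coe_iff.2 (by simp only; linarith)⟩
  refine absurd hsup (not_lt.2 ?_)
  refine (mul_spatialDist_le_grwDist (Z := Z) (f := f) (half_pos hη).le (fun p hp => ?_)
    (r, x) (r, y)).trans ((grwDist_le_grwDiam (hmem x) (hmem y)).trans
      (le_iSup_of_le (r - κ / 2) (le_iSup_of_le (r + κ / 2) (le_iSup_of_le
        ⟨hu.1.le, by linarith, hv.2.1.le, hv.2.2.1.le⟩ le_rfl))))
  exact (hκ (hdist p.1 (EReal.coe_lt_coe_iff.1 hp.1).le
    (EReal.coe_lt_coe_iff.1 hp.2).le)).2.2.2.le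

end Uniform

/-! ### Assembly of the theorem -/

theorem mainTheorem1 {n : ℕ} {S : Type*} [TopologicalSpace S] [T2Space S] [ConnectedSpace S]
    [Nontrivial S] [ChartedSpace (EuclideanSpace ℝ (Fin n)) S] [IsManifold (𝓡 n) ∞ S]
    (h : SpatialMetric n S) (b : EReal) (hb : 0 < b) (f : ℝ → ℝ)
    (hf : ContDiffOn ℝ ∞ f {t : ℝ | 0 < t ∧ (t : EReal) < b})
    (hf_pos : ∀ t : ℝ, 0 < t → (t : EReal) < b → 0 < f t) (Z : DistKind) :
    -- the time function has a unique continuous extension to the completion, and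
    (∃! τ : GRWCompletion h f b Z → ℝ, Continuous τ ∧ ∀ p : GRWSpace h f b Z, τ p = p.time) ∧
    -- for this extension, the three pinching conditions are equivalent, and
    (∀ τ : GRWCompletion h f b Z → ℝ, Continuous τ →
      (∀ p : GRWSpace h f b Z, τ p = p.time) →
      List.TFAE [
        ∃ t : ℕ → ℝ, (∀ k, 0 < t k ∧ (t k : EReal) < b) ∧ Tendsto t atTop (𝓝 0) ∧
          Tendsto (fun k => f (t k)) atTop (𝓝 0),
        Tendsto (fun t : ℝ => grwDiam h f Z (slab S 0 b) (slab S 0 t)) (𝓝[>] 0) (𝓝 0),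
        ∃ p₀ : GRWCompletion h f b Z, τ ⁻¹' {0} = {p₀}]) ∧
    -- if `diam S < ∞`, the two uniform pinching conditions are equivalent
    (spatialDiam h < ⊤ →
      (Tendsto f (𝓝[>] 0) (𝓝 0) ↔
        Tendsto (fun t : ℝ => ⨆ (u : ℝ) (v : ℝ) (_ : 0 ≤ u ∧ u < v ∧ v ≤ t ∧ (v : EReal) ≤ b),
          grwDiam h f Z (slab S u v) (slab S u v)) (𝓝[>] 0) (𝓝 0))) := by
  refine ⟨existsUnique_continuous_extension_time, fun τ hτ hτt => ?_, fun hS =>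
    ⟨tendsto_iSup_grwDiam hf hf_pos hS, tendsto_of_tendsto_iSup_grwDiam hb hf hf_pos⟩⟩
  tfae_have 1 → 2 := by
    rintro ⟨t, ht, ht0, hft⟩
    have hlim : Tendsto (fun s : ℝ => ENNReal.ofReal s + ENNReal.ofReal s) (𝓝[>] 0) (𝓝 0) := by
      have h1 : Tendsto (fun s : ℝ => ENNReal.ofReal s) (𝓝[>] 0) (𝓝 (ENNReal.ofReal 0)) :=
        ENNReal.tendsto_ofReal (tendsto_id.mono_left nhdsWithin_le_nhds)
      simpa using h1.add h1
    refine tendsto_of_tendsto_of_tendsto_of_le_of_le' tendsto_const_nhds hlim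
      (Eventually.of_forall fun _ => bot_le) ?_
    filter_upwards [eventually_lt_of_pos hb] with s hs
    exact grwDiam_le_of_tendsto hf hf_pos ht ht0 hft hs.1 hs.2
  tfae_have 2 → 3 := by
    intro hdiam
    obtain ⟨t, ht, ht0⟩ := exists_seq_tendsto_zero hb
    -- The limit of a vertical line shows that the fibre over zero is non-empty.
    obtain ⟨P, hP⟩ := exists_tendsto_vertical (h := h) (f := f) (Z := Z) ht ht0
      (Classical.arbitrary S)
    have hτP : τ P = 0 := by
      refine tendsto_nhds_unique ((hτ.tendsto P).comp hP) (ht0.congr fun k => ?_)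
      exact (hτt (GRWSpace.point (ht k) _)).symm
    refine ⟨P, Subset.antisymm (fun Q hQ => ?_) (by simpa using hτP)⟩
    exact eq_of_tendsto_grwDiam hb hdiam hτ hτt hQ hτP
  tfae_have 3 → 1 := fun ⟨_, hp₀⟩ => exists_seq_of_existsUnique hb hτ hτt hp₀ hf_pos
  tfae_finish
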